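/- Let $\mathcal G\rightrightarrows M$ be a Lie groupoid with source $\mathsf s$, target $\mathsf t$, inversion $\mathrm{inv}$ and unit embedding $M\hookrightarrow\mathcal G$, and let $E=\mathrm{Lie}(\mathcal G)=\mathsf T\mathcal G|_M/\mathsf TM$ be its Lie algebroid, with anchor $\alpha:E\to\mathsf TM$ induced by $\mathsf T\mathsf s-\mathsf T\mathsf t$. For a section $X$ of $E$ let $X^L$ (tangent to the target fibres) and $X^R$ (tangent to the source fibres) be the left- and right-invariant vector fields on $\mathcal G$ that represent $X$ along $M$. Let $F:\mathcal G\to\mathbb R$ be a contrast function, i.e. a smooth function with $F|_M=0$ and $dF|_M=0$, and put $F^*=F\circ\mathrm{inv}$. Let $g^F$ be the symmetric $2$-form on $E$ given by $g^F(X,Y)=\tilde X\tilde YF|_M$ for any vector fields $\tilde X,\tilde Y$ on $\mathcal G$ representing $X,Y$ along $M$, and let $K^F=\{X\in E: g^F(X,\cdot)=0\}$. Suppose that $F$ is a Koszul contrast function: $K^F$ has constant rank, and $X^LY^LZ^RF|_M=0$ and $X^LY^LZ^RF^*|_M=0$ for all smooth sections $X,Y$ of $E$ and all smooth sections $Z$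 of $K^F$. Write $\bar Y$ for the class of $Y$ in $E/K^F$ and $g^{[F]}(\bar Y,\bar Z)=g^F(Y,Z)$ for the transversal metric on $E/K^F$. Then for all smooth sections $X,Y$ of $E$ there are unique sections $\nabla^F_XY$ and $\nabla^{F^*}_XY$ of $E/K^F$ such that, for all smooth sections $Z$ of $E$, $$g^{[F]}(\nabla^F_XY,\bar Z)=X^LY^LZ^RF|_M,\qquad g^{[F]}(\nabla^{F^*}_XY,\bar Z)=X^LY^LZ^RF^*|_M ,$$ and these sections are smooth. For all smooth sections $X,Y,Z$ of $E$ the function $g^F(Y,Z)$ is smooth and $$g^F(\nabla^F_XY,Z)+g^F(Y,\nabla^{F^*}_XZ)=\alpha(X)\,g^F(Y,Z),$$ where arbitrary representatives in $E$ of $\nabla^F_XY$ and $\nabla^{F^*}_XZ$ may be inserted; equivalently, $$g^{[F]}(\nabla^F_XY,\bar Z)+g^{[F]}(\bar Y,\nabla^{F^*}_XZ)=\alpha(X)\,g^{[F]}(\bar Y,\bar Z).$$ Moreover $\nabla^F_XY$ and $\nabla^{F^*}_XY$ depend on $Y$ only through $\bar Y$, so that $\nabla^F_X$ and $\nabla^{F^*}_X$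 induce operators $\nabla^{[F]}_X$ and $\nabla^{[F^*]}_X$ on the smooth sections of $E/K^F$, and these are dual with respect to the transversal metric: for all smooth sections $\sigma,\tau$ of $E/K^F$, $$g^{[F]}(\nabla^{[F]}_X\sigma,\tau)+g^{[F]}(\sigma,\nabla^{[F^*]}_X\tau)=\alpha(X)\,g^{[F]}(\sigma,\tau).$$ -/

import Mathlib

open scoped Manifold ContDiff Topology

noncomputable section

/-- A Lie groupoid `G ⇉ M`, where `M` and `G` are smooth manifolds without boundary modelled on
`EM` and `EG`.  `mul g h` is the composition `g ∘ h`; only its values at composable pairs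
(`src g = tgt h`) are meaningful.  Since `src ∘ unit = id`, the smooth map `unit` is automatically
an embedding of `M` into `G`. -/
structure LieGroupoid (EM : Type*) [NormedAddCommGroup EM] [NormedSpace ℝ EM]
    (M : Type*) [TopologicalSpace M] [ChartedSpace EM M]
    (EG : Type*) [NormedAddCommGroup EG] [NormedSpace ℝ EG]
    (G : Type*) [TopologicalSpace G] [ChartedSpace EG G] where
  src : G → M
  tgt : G → M
  unit : M → G
  mul : G → G → G
  inv : G → G
  isSubmersion_src : Manifold.IsSubmersion 𝓘(ℝ, EG) 𝓘(ℝ, EM) ∞ src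
  isSubmersion_tgt : Manifold.IsSubmersion 𝓘(ℝ, EG) 𝓘(ℝ, EM) ∞ tgt
  contMDiff_unit : ContMDiff 𝓘(ℝ, EM) 𝓘(ℝ, EG) ∞ unit
  contMDiff_inv : ContMDiff 𝓘(ℝ, EG) 𝓘(ℝ, EG) ∞ inv
  contMDiffOn_mul : ContMDiffOn (𝓘(ℝ, EG).prod 𝓘(ℝ, EG)) 𝓘(ℝ, EG) ∞
    (fun p : G × G => mul p.1 p.2) {p : G × G | src p.1 = tgt p.2}
  src_unit : ∀ x, src (unit x) = x
  tgt_unit : ∀ x, tgt (unit x) = x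
  src_mul : ∀ g h, src g = tgt h → src (mul g h) = src h
  tgt_mul : ∀ g h, src g = tgt h → tgt (mul g h) = tgt g
  mul_assoc : ∀ g h k, src g = tgt h → src h = tgt k → mul (mul g h) k = mul g (mul h k)
  unit_mul : ∀ g, mul (unit (tgt g)) g = g
  mul_unit : ∀ g, mul g (unit (src g)) = g
  src_inv : ∀ g, src (inv g) = tgt g
  tgt_inv : ∀ g, tgt (inv g) = src g
  mul_inv : ∀ g, mul g (inv g) = unit (tgt g)
  inv_mul : ∀ g, mul (inv g) g = unit (src g)

namespace LieGroupoid

variable {EM : Type*} [NormedAddCommGroup EM] [NormedSpace ℝ EM]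
  {M : Type*} [TopologicalSpace M] [ChartedSpace EM M]
  {EG : Type*} [NormedAddCommGroup EG] [NormedSpace ℝ EG]
  {G : Type*} [TopologicalSpace G] [ChartedSpace EG G]
  (𝒢 : LieGroupoid EM M EG G)

/-- The differential `Tι : T_x M → T_{ι x} G` of the unit embedding `ι`. -/
def dUnit (x : M) : TangentSpace 𝓘(ℝ, EM) x →L[ℝ] TangentSpace 𝓘(ℝ, EG) (𝒢.unit x) :=
  mfderiv 𝓘(ℝ, EM) 𝓘(ℝ, EG) 𝒢.unit x

/-- The differential `T_{ι x} G → T_x M` of the source map at a unit. -/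
def dSrc (x : M) : TangentSpace 𝓘(ℝ, EG) (𝒢.unit x) →L[ℝ] TangentSpace 𝓘(ℝ, EM) x :=
  mfderiv 𝓘(ℝ, EG) 𝓘(ℝ, EM) 𝒢.src (𝒢.unit x)

/-- The differential `T_{ι x} G → T_x M` of the target map at a unit. -/
def dTgt (x : M) : TangentSpace 𝓘(ℝ, EG) (𝒢.unit x) →L[ℝ] TangentSpace 𝓘(ℝ, EM) x :=
  mfderiv 𝓘(ℝ, EG) 𝓘(ℝ, EM) 𝒢.tgt (𝒢.unit x)

theorem dSrc_dUnit (x : M) (v : TangentSpace 𝓘(ℝ, EM) x) : 𝒢.dSrc x (𝒢.dUnit x v) = v := by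
  have hs : MDifferentiableAt 𝓘(ℝ, EG) 𝓘(ℝ, EM) 𝒢.src (𝒢.unit x) :=
    𝒢.isSubmersion_src.contMDiff.mdifferentiable (by simp) _
  have hu : MDifferentiableAt 𝓘(ℝ, EM) 𝓘(ℝ, EG) 𝒢.unit x :=
    𝒢.contMDiff_unit.mdifferentiable (by simp) _
  have h := mfderiv_comp x hs hu
  have hid : 𝒢.src ∘ 𝒢.unit = id := funext 𝒢.src_unit
  rw [hid, mfderiv_id] at h
  exact (DFunLike.congr_fun h v).symm

theorem dTgt_dUnit (x : M) (v : TangentSpace 𝓘(ℝ, EM) x) : 𝒢.dTgt x (𝒢.dUnit x v) = v := by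
  have hs : MDifferentiableAt 𝓘(ℝ, EG) 𝓘(ℝ, EM) 𝒢.tgt (𝒢.unit x) :=
    𝒢.isSubmersion_tgt.contMDiff.mdifferentiable (by simp) _
  have hu : MDifferentiableAt 𝓘(ℝ, EM) 𝓘(ℝ, EG) 𝒢.unit x :=
    𝒢.contMDiff_unit.mdifferentiable (by simp) _
  have h := mfderiv_comp x hs hu
  have hid : 𝒢.tgt ∘ 𝒢.unit = id := funext 𝒢.tgt_unit
  rw [hid, mfderiv_id] at h
  exact (DFunLike.congr_fun h v).symm

/-! ### The Lie algebroid `E = Lie(G)`: the normal bundle `TG|_M / TM` -/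

/-- The fibre `E_x = T_{ι x} G / T_x M` of the Lie algebroid. -/
abbrev Fibre (x : M) : Type _ :=
  TangentSpace 𝓘(ℝ, EG) (𝒢.unit x) ⧸ LinearMap.range (𝒢.dUnit x).toLinearMap

/-- The anchor `E_x → T_x M`, induced by `Ts - Tt`. -/
def anchor (x : M) : 𝒢.Fibre x →ₗ[ℝ] TangentSpace 𝓘(ℝ, EM) x :=
  Submodule.liftQ _ ((𝒢.dSrc x).toLinearMap - (𝒢.dTgt x).toLinearMap) (by
    rintro _ ⟨v, rfl⟩
    simp [dSrc_dUnit, dTgt_dUnit])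

/-- The unique representative of a normal vector that is tangent to the target fibre:
it is `v - Tι (Tt v)` for an arbitrary representative `v`. -/
def leftRep (x : M) : 𝒢.Fibre x →ₗ[ℝ] TangentSpace 𝓘(ℝ, EG) (𝒢.unit x) :=
  Submodule.liftQ _
    (LinearMap.id - (𝒢.dUnit x).toLinearMap ∘ₗ (𝒢.dTgt x).toLinearMap) (by
    rintro _ ⟨v, rfl⟩
    simp [dTgt_dUnit])

/-- The unique representative of a normal vector that is tangent to the source fibre:
it is `v - Tι (Ts v)` for an arbitrary representative `v`. -/
def rightRep (x : M) : 𝒢.Fibre x →ₗ[ℝ] TangentSpace 𝓘(ℝ, EG) (𝒢.unit x) :=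
  Submodule.liftQ _
    (LinearMap.id - (𝒢.dUnit x).toLinearMap ∘ₗ (𝒢.dSrc x).toLinearMap) (by
    rintro _ ⟨v, rfl⟩
    simp [dSrc_dUnit])

theorem mk_leftRep (x : M) (e : 𝒢.Fibre x) : Submodule.Quotient.mk (𝒢.leftRep x e) = e := by
  obtain ⟨v, rfl⟩ := Submodule.Quotient.mk_surjective _ e
  refine (Submodule.Quotient.eq _).2 ⟨-(𝒢.dTgt x v), ?_⟩
  simp [leftRep]

theorem mk_rightRep (x : M) (e : 𝒢.Fibre x) : Submodule.Quotient.mk (𝒢.rightRep x e) = e := by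
  obtain ⟨v, rfl⟩ := Submodule.Quotient.mk_surjective _ e
  refine (Submodule.Quotient.eq _).2 ⟨-(𝒢.dSrc x v), ?_⟩
  simp [rightRep]

theorem dTgt_leftRep (x : M) (e : 𝒢.Fibre x) : 𝒢.dTgt x (𝒢.leftRep x e) = 0 := by
  obtain ⟨v, rfl⟩ := Submodule.Quotient.mk_surjective _ e
  simp [leftRep, dTgt_dUnit]

theorem dSrc_rightRep (x : M) (e : 𝒢.Fibre x) : 𝒢.dSrc x (𝒢.rightRep x e) = 0 := by
  obtain ⟨v, rfl⟩ := Submodule.Quotient.mk_surjective _ e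
  simp [rightRep, dSrc_dUnit]

/-- Smoothness of a section of `E → M`, with `E` identified, as a vector bundle, with the
subbundle `Ker Tt|_M` of `TG|_M`. -/
def IsSmoothSection [IsManifold 𝓘(ℝ, EG) ∞ G] (X : ∀ x, 𝒢.Fibre x) : Prop :=
  ContMDiff 𝓘(ℝ, EM) 𝓘(ℝ, EG).tangent ∞
    (fun x => (⟨𝒢.unit x, 𝒢.leftRep x (X x)⟩ : TangentBundle 𝓘(ℝ, EG) G))

/-- The left-invariant vector field `X^L` on `G` with `X^L|_M ∼ X`: the value at `g` is
`T L_g (X^L (ι (s g)))`, where `L_g h = g ∘ h` is defined on the target fibre over `s g`. -/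
def leftField (X : ∀ x, 𝒢.Fibre x) (g : G) : TangentSpace 𝓘(ℝ, EG) g :=
  (mfderivWithin 𝓘(ℝ, EG) 𝓘(ℝ, EG) (fun h => 𝒢.mul g h) {h | 𝒢.tgt h = 𝒢.src g}
    (𝒢.unit (𝒢.src g)) (𝒢.leftRep (𝒢.src g) (X (𝒢.src g))) :)

/-- The right-invariant vector field `X^R` on `G` with `X^R|_M ∼ X`: the value at `g` is
`T R_g (X^R (ι (t g)))`, where `R_g h = h ∘ g` is defined on the source fibre over `t g`. -/
def rightField (X : ∀ x, 𝒢.Fibre x) (g : G) : TangentSpace 𝓘(ℝ, EG) g :=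
  (mfderivWithin 𝓘(ℝ, EG) 𝓘(ℝ, EG) (fun h => 𝒢.mul h g) {h | 𝒢.src h = 𝒢.tgt g}
    (𝒢.unit (𝒢.tgt g)) (𝒢.rightRep (𝒢.tgt g) (X (𝒢.tgt g))) :)

/-- The derivative `V f` of a function `f` on `G` along a vector field `V`. -/
def fieldDeriv (V : ∀ g : G, TangentSpace 𝓘(ℝ, EG) g) (f : G → ℝ) (g : G) : ℝ :=
  mfderiv 𝓘(ℝ, EG) 𝓘(ℝ, ℝ) f g (V g)

/-- The derivative `α(X) f` of a function `f` on `M` along the anchor of `X`. -/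
def anchorDeriv (X : ∀ x, 𝒢.Fibre x) (f : M → ℝ) (x : M) : ℝ :=
  mfderiv 𝓘(ℝ, EM) 𝓘(ℝ, ℝ) f x (𝒢.anchor x (X x))

/-- The function `X^L Y^L Z^R f |_M`. -/
def thirdDeriv (f : G → ℝ) (X Y Z : ∀ x, 𝒢.Fibre x) (x : M) : ℝ :=
  fieldDeriv (𝒢.leftField X) (fieldDeriv (𝒢.leftField Y) (fieldDeriv (𝒢.rightField Z) f))
    (𝒢.unit x)

/-! ### Contrast functions -/

/-- A contrast function: a smooth function on `G` vanishing on `M`, with `dF|_M = 0`. -/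
structure ContrastFunction where
  toFun : G → ℝ
  contMDiff : ContMDiff 𝓘(ℝ, EG) 𝓘(ℝ, ℝ) ∞ toFun
  apply_unit : ∀ x, toFun (𝒢.unit x) = 0
  mfderiv_unit : ∀ x, mfderiv 𝓘(ℝ, EG) 𝓘(ℝ, ℝ) toFun (𝒢.unit x) = 0

theorem inv_unit (x : M) : 𝒢.inv (𝒢.unit x) = 𝒢.unit x := by
  have h := 𝒢.mul_inv (𝒢.unit x)
  have h2 := 𝒢.unit_mul (𝒢.inv (𝒢.unit x))
  rw [𝒢.tgt_inv, 𝒢.src_unit] at h2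
  rw [h2, 𝒢.tgt_unit] at h
  exact h

namespace ContrastFunction

variable {𝒢} (F : 𝒢.ContrastFunction)

/-- The contrast function `F^* = F ∘ inv`. -/
def star : 𝒢.ContrastFunction where
  toFun := F.toFun ∘ 𝒢.inv
  contMDiff := F.contMDiff.comp 𝒢.contMDiff_inv
  apply_unit x := by simp [inv_unit, F.apply_unit]
  mfderiv_unit x := by
    have h1 : MDifferentiableAt 𝓘(ℝ, EG) 𝓘(ℝ, ℝ) F.toFun (𝒢.inv (𝒢.unit x)) :=
      F.contMDiff.mdifferentiable (by simp) _
    have h2 : MDifferentiableAt 𝓘(ℝ, EG) 𝓘(ℝ, EG) 𝒢.inv (𝒢.unit x) :=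
      𝒢.contMDiff_inv.mdifferentiable (by simp) _
    have h := mfderiv_comp (𝒢.unit x) h1 h2
    have h3 : mfderiv 𝓘(ℝ, EG) 𝓘(ℝ, ℝ) F.toFun (𝒢.inv (𝒢.unit x)) = 0 := by
      have h4 := F.mfderiv_unit x
      rw [← 𝒢.inv_unit x] at h4
      exact h4
    rw [h, h3]
    ext v
    rfl

/-- The Hessian of `F` at the critical point `ι x`, computed in the preferred chart there (the
chart which identifies the tangent space at `ι x` with the model space). -/
def hessian (x : M) :
    TangentSpace 𝓘(ℝ, EG) (𝒢.unit x) →ₗ[ℝ] TangentSpace 𝓘(ℝ, EG) (𝒢.unit x) →ₗ[ℝ] ℝ :=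
  (ContinuousLinearMap.coeLM ℝ :
      (EG →L[ℝ] ℝ) →ₗ[ℝ] (EG →ₗ[ℝ] ℝ)) ∘ₗ
    (fderiv ℝ (fderiv ℝ (F.toFun ∘ (extChartAt 𝓘(ℝ, EG) (𝒢.unit x)).symm))
      (extChartAt 𝓘(ℝ, EG) (𝒢.unit x) (𝒢.unit x))).toLinearMap

theorem contDiffAt_localRep [IsManifold 𝓘(ℝ, EG) ∞ G] (x : M) :
    ContDiffAt ℝ ∞ (F.toFun ∘ (extChartAt 𝓘(ℝ, EG) (𝒢.unit x)).symm)
      (extChartAt 𝓘(ℝ, EG) (𝒢.unit x) (𝒢.unit x)) := by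
  have h1 := (contMDiffAt_iff.1 (F.contMDiff (𝒢.unit x))).2
  rw [extChartAt_model_space_eq_id] at h1
  simpa [contDiffWithinAt_univ] using h1

theorem hessian_symm [IsManifold 𝓘(ℝ, EG) ∞ G] (x : M)
    (v w : TangentSpace 𝓘(ℝ, EG) (𝒢.unit x)) : F.hessian x v w = F.hessian x w v :=
  ((F.contDiffAt_localRep x).isSymmSndFDerivAt
    (by rw [minSmoothness_of_isRCLikeNormedField]; exact WithTop.coe_le_coe.2 le_top)) v w

theorem fderiv_localRep [IsManifold 𝓘(ℝ, EG) ∞ G] (x y : M)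
    (hy : 𝒢.unit y ∈ (chartAt EG (𝒢.unit x)).source) :
    fderiv ℝ (F.toFun ∘ (extChartAt 𝓘(ℝ, EG) (𝒢.unit x)).symm)
      (extChartAt 𝓘(ℝ, EG) (𝒢.unit x) (𝒢.unit y)) = 0 := by
  set φ := extChartAt 𝓘(ℝ, EG) (𝒢.unit x) with hφ
  have hy' : 𝒢.unit y ∈ φ.source := by rw [extChartAt_source]; exact hy
  have h1 : φ.symm (φ (𝒢.unit y)) = 𝒢.unit y := φ.left_inv hy'
  have h2 : MDifferentiableAt 𝓘(ℝ, EG) 𝓘(ℝ, EG) φ.symm (φ (𝒢.unit y)) := by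
    have := mdifferentiableWithinAt_extChartAt_symm (I := 𝓘(ℝ, EG)) (φ.map_source hy')
    rw [modelWithCornersSelf_coe, Set.range_id, mdifferentiableWithinAt_univ] at this
    exact this
  have h3 : MDifferentiableAt 𝓘(ℝ, EG) 𝓘(ℝ, ℝ) F.toFun (φ.symm (φ (𝒢.unit y))) :=
    F.contMDiff.mdifferentiable (by simp) _
  have h4 := mfderiv_comp (φ (𝒢.unit y)) h3 h2
  have h5 : mfderiv 𝓘(ℝ, EG) 𝓘(ℝ, ℝ) F.toFun (φ.symm (φ (𝒢.unit y))) = 0 := by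
    have h6 := F.mfderiv_unit y
    rw [← h1] at h6
    exact h6
  rw [h5, mfderiv_eq_fderiv] at h4
  rw [h4]
  ext v
  rfl

/-- For vector fields `V`, `W` on `G`, `W` differentiable at `ι x`, the value of `V (W F)` at `ι x`
is given by the Hessian. -/
theorem fieldDeriv_fieldDeriv_unit [IsManifold 𝓘(ℝ, EG) ∞ G] (x : M)
    (V W : ∀ g : G, TangentSpace 𝓘(ℝ, EG) g)
    (hW : MDifferentiableAt 𝓘(ℝ, EG) 𝓘(ℝ, EG).tangent
      (fun g => (⟨g, W g⟩ : TangentBundle 𝓘(ℝ, EG) G)) (𝒢.unit x)) :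
    fieldDeriv V (fieldDeriv W F.toFun) (𝒢.unit x) =
      F.hessian x (V (𝒢.unit x)) (W (𝒢.unit x)) := by
  set g₀ := 𝒢.unit x with hg₀
  set φ := extChartAt 𝓘(ℝ, EG) g₀ with hφ
  set f : EG → ℝ := F.toFun ∘ φ.symm with hf
  have hfs : ContDiffAt ℝ ∞ f (φ g₀) := F.contDiffAt_localRep x
  have hfd : DifferentiableAt ℝ (fderiv ℝ f) (φ g₀) :=
    (hfs.fderiv_right (m := 1) (WithTop.coe_le_coe.2 le_top)).differentiableAt (by simp)
  let w : G → EG := fun g => (trivializationAt EG (TangentSpace 𝓘(ℝ, EG)) g₀ ⟨g, W g⟩).2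
  have hw : MDifferentiableAt 𝓘(ℝ, EG) 𝓘(ℝ, EG) w g₀ :=
    (mdifferentiableAt_section (IB := 𝓘(ℝ, EG)) (F := EG) (E := TangentSpace 𝓘(ℝ, EG)) W).1 hW
  have hA : MDifferentiableAt 𝓘(ℝ, EG) 𝓘(ℝ, EG →L[ℝ] ℝ) (fun g => fderiv ℝ f (φ g)) g₀ :=
    (DifferentiableAt.mdifferentiableAt hfd).comp g₀
      (mdifferentiableAt_extChartAt (mem_chart_source EG g₀))
  -- the function `W F` near `g₀`
  have hev : fieldDeriv W F.toFun =ᶠ[𝓝 g₀] fun g => fderiv ℝ f (φ g) (w g) := by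
    have h1 : ∀ᶠ g in 𝓝 g₀, g ∈ (chartAt EG g₀).source :=
      (chartAt EG g₀).open_source.mem_nhds (mem_chart_source EG g₀)
    have h2 : ∀ᶠ g in 𝓝 g₀, DifferentiableAt ℝ f (φ g) := by
      have h3 : ∀ᶠ u in 𝓝 (φ g₀), DifferentiableAt ℝ f u := by
        have h4 : ContDiffAt ℝ 1 f (φ g₀) := hfs.of_le (WithTop.coe_le_coe.2 le_top)
        filter_upwards [h4.eventually (by simp)] with u hu
        exact hu.differentiableAt (by simp)
      exact (continuousAt_extChartAt g₀).eventually h3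
    filter_upwards [h1, h2] with g hg hgf
    have h5 : F.toFun =ᶠ[𝓝 g] f ∘ φ := by
      filter_upwards [(chartAt EG g₀).open_source.mem_nhds hg] with k hk
      have : φ.symm (φ k) = k := φ.left_inv (by rw [extChartAt_source]; exact hk)
      simp [hf, this]
    have h6 : mfderiv 𝓘(ℝ, EG) 𝓘(ℝ, ℝ) F.toFun g =
        (mfderiv 𝓘(ℝ, EG) 𝓘(ℝ, ℝ) f (φ g)).comp (mfderiv 𝓘(ℝ, EG) 𝓘(ℝ, EG) φ g) := by
      rw [h5.mfderiv_eq]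
      exact mfderiv_comp g hgf.mdifferentiableAt (mdifferentiableAt_extChartAt hg)
    have h7 : mfderiv 𝓘(ℝ, EG) 𝓘(ℝ, EG) φ g (W g) = w g := by
      have := mfderiv_chartAt_eq_tangentCoordChange (I := 𝓘(ℝ, EG)) (x := g) (y := g₀) hg
      exact DFunLike.congr_fun this (W g)
    show mfderiv 𝓘(ℝ, EG) 𝓘(ℝ, ℝ) F.toFun g (W g) = _
    rw [h6, mfderiv_eq_fderiv]
    exact congrArg (fderiv ℝ f (φ g)) h7
  have hA0 : fderiv ℝ f (φ g₀) = 0 := F.fderiv_localRep x x (mem_chart_source EG g₀)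
  have hw0 : w g₀ = W g₀ :=
    tangentCoordChange_self (I := 𝓘(ℝ, EG)) (mem_extChartAt_source g₀)
  have hB := (isBoundedBilinearMap_apply (𝕜 := ℝ) (E := EG) (F := ℝ)).hasFDerivAt
    (fderiv ℝ f (φ g₀), w g₀)
  have hpair : MDifferentiableAt 𝓘(ℝ, EG) 𝓘(ℝ, (EG →L[ℝ] ℝ) × EG)
      (fun g => (fderiv ℝ f (φ g), w g)) g₀ := hA.prodMk_space hw
  have hcomp := HasMFDerivAt.comp g₀ hB.hasMFDerivAt hpair.hasMFDerivAt
  have hφ1 : mfderiv 𝓘(ℝ, EG) 𝓘(ℝ, EG →L[ℝ] ℝ) (fun g => fderiv ℝ f (φ g)) g₀ =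
      fderiv ℝ (fderiv ℝ f) (φ g₀) := by
    have h1 := mfderiv_comp g₀ hfd.mdifferentiableAt
      (mdifferentiableAt_extChartAt (I := 𝓘(ℝ, EG)) (mem_chart_source EG g₀))
    rw [mfderiv_extChartAt_self, mfderiv_eq_fderiv] at h1
    exact h1
  have hp1 : ∀ v : TangentSpace 𝓘(ℝ, EG) g₀,
      (mfderiv 𝓘(ℝ, EG) 𝓘(ℝ, (EG →L[ℝ] ℝ) × EG) (fun g => (fderiv ℝ f (φ g), w g)) g₀ v).1 =
        fderiv ℝ (fderiv ℝ f) (φ g₀) v := by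
    intro v
    have h1 := HasMFDerivAt.comp g₀
      ((ContinuousLinearMap.fst ℝ (EG →L[ℝ] ℝ) EG).hasFDerivAt (x := (fderiv ℝ f (φ g₀), w g₀))
        ).hasMFDerivAt hpair.hasMFDerivAt
    have h2 := h1.mfderiv
    have h3 := hφ1.symm.trans h2
    exact (DFunLike.congr_fun h3 v).symm
  show mfderiv 𝓘(ℝ, EG) 𝓘(ℝ, ℝ) (fieldDeriv W F.toFun) g₀ (V g₀) = _
  rw [hev.mfderiv_eq]
  have h8 := DFunLike.congr_fun hcomp.mfderiv (V g₀)
  refine h8.trans ?_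
  rw [← hw0]
  have h9 := congrArg (fun L : EG →L[ℝ] ℝ => L (w g₀)) (hp1 (V g₀))
  have h10 : ∀ p : (EG →L[ℝ] ℝ) × EG,
      (isBoundedBilinearMap_apply (𝕜 := ℝ) (E := EG) (F := ℝ)).deriv (fderiv ℝ f (φ g₀), w g₀) p =
        p.1 (w g₀) := by
    intro p
    rw [IsBoundedBilinearMap.deriv]
    simp [hA0]
  exact (h10 _).trans h9

/-- The Hessian vanishes on vectors tangent to `M`. -/
theorem hessian_dUnit [IsManifold 𝓘(ℝ, EG) ∞ G] (x : M)
    (v : TangentSpace 𝓘(ℝ, EM) x) : F.hessian x (𝒢.dUnit x v) = 0 := by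
  set φ := extChartAt 𝓘(ℝ, EG) (𝒢.unit x) with hφ
  set f : EG → ℝ := F.toFun ∘ φ.symm with hf
  have hfs : ContDiffAt ℝ ∞ f (φ (𝒢.unit x)) := F.contDiffAt_localRep x
  have hfd : DifferentiableAt ℝ (fderiv ℝ f) (φ (𝒢.unit x)) :=
    (hfs.fderiv_right (m := 1) (WithTop.coe_le_coe.2 le_top)).differentiableAt (by simp)
  have hι : MDifferentiableAt 𝓘(ℝ, EM) 𝓘(ℝ, EG) 𝒢.unit x :=
    𝒢.contMDiff_unit.mdifferentiable (by simp) _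
  have hφd := hasMFDerivAt_extChartAt (I := 𝓘(ℝ, EG)) (mem_chart_source EG (𝒢.unit x))
  have h1 := mfderiv_comp (𝒢.unit x) hfd.mdifferentiableAt hφd.mdifferentiableAt
  rw [mfderiv_extChartAt_self, mfderiv_eq_fderiv] at h1
  have h2 := mfderiv_comp x (hfd.mdifferentiableAt.comp (𝒢.unit x) hφd.mdifferentiableAt) hι
  rw [h1] at h2
  have h3 : (fderiv ℝ f ∘ φ) ∘ 𝒢.unit =ᶠ[𝓝 x] fun _ => 0 := by
    filter_upwards [𝒢.contMDiff_unit.continuous.continuousAt.eventually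
      ((chartAt EG (𝒢.unit x)).open_source.mem_nhds (mem_chart_source EG (𝒢.unit x)))] with y hy
    exact F.fderiv_localRep x y hy
  rw [h3.mfderiv_eq, mfderiv_const] at h2
  have h4 := DFunLike.congr_fun h2 v
  exact LinearMap.ext fun u => (congrArg (fun L : EG →L[ℝ] ℝ => L u) h4).symm

/-- The symmetric 2-form `g^F` on `E`. Here `g^F(X, Y) = X̃ Ỹ F |_M` for any vector fields `X̃`, `Ỹ`
on `G` that represent `X`, `Y` along `M`; see `metric_eq`. -/
def metric (x : M) : 𝒢.Fibre x →ₗ[ℝ] 𝒢.Fibre x →ₗ[ℝ] ℝ :=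
  (F.hessian x).compl₁₂ (𝒢.leftRep x) (𝒢.leftRep x)

theorem metric_symm [IsManifold 𝓘(ℝ, EG) ∞ G] (x : M) (e e' : 𝒢.Fibre x) :
    F.metric x e e' = F.metric x e' e :=
  F.hessian_symm x _ _

theorem metric_mk [IsManifold 𝓘(ℝ, EG) ∞ G] (x : M)
    (v w : TangentSpace 𝓘(ℝ, EG) (𝒢.unit x)) :
    F.metric x (Submodule.Quotient.mk v) (Submodule.Quotient.mk w) = F.hessian x v w := by
  have h1 : ∀ u, F.hessian x (𝒢.dUnit x u) = 0 := F.hessian_dUnit x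
  have h2 : ∀ v u, F.hessian x v (𝒢.dUnit x u) = 0 := fun v u => by
    rw [F.hessian_symm, h1]; rfl
  show F.hessian x (v - 𝒢.dUnit x (𝒢.dTgt x v)) (w - 𝒢.dUnit x (𝒢.dTgt x w)) = _
  rw [map_sub, map_sub, h1, sub_zero, h2, sub_zero]

/-- `g^F(X, Y) = X̃ Ỹ F |_M` for any vector fields `X̃`, `Ỹ` representing `X`, `Y` along `M`. -/
theorem metric_eq [IsManifold 𝓘(ℝ, EG) ∞ G] (x : M) (X Y : ∀ x, 𝒢.Fibre x)
    (V W : ∀ g : G, TangentSpace 𝓘(ℝ, EG) g)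
    (hW : MDifferentiableAt 𝓘(ℝ, EG) 𝓘(ℝ, EG).tangent
      (fun g => (⟨g, W g⟩ : TangentBundle 𝓘(ℝ, EG) G)) (𝒢.unit x))
    (hVX : Submodule.Quotient.mk (V (𝒢.unit x)) = X x)
    (hWY : Submodule.Quotient.mk (W (𝒢.unit x)) = Y x) :
    F.metric x (X x) (Y x) = fieldDeriv V (fieldDeriv W F.toFun) (𝒢.unit x) := by
  rw [← hVX, ← hWY, F.metric_mk, F.fieldDeriv_fieldDeriv_unit x V W hW]

/-- The kernel `K^F` of `g^F`. -/
def kernel (x : M) : Submodule ℝ (𝒢.Fibre x) :=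
  LinearMap.ker (F.metric x)

/-- The fibres of `L^F = E / K^F`. -/
abbrev TransFibre (x : M) : Type _ := 𝒢.Fibre x ⧸ F.kernel x

/-- The coset `Ȳ`, a section of `E / K^F`, of a section `Y` of `E`. -/
def coset (Y : ∀ x, 𝒢.Fibre x) (x : M) : F.TransFibre x := Submodule.Quotient.mk (Y x)

/-- The transversal metric `g^{[F]}` on `E / K^F`. -/
def transMetric [IsManifold 𝓘(ℝ, EG) ∞ G] (x : M) :
    F.TransFibre x →ₗ[ℝ] F.TransFibre x →ₗ[ℝ] ℝ :=
  Submodule.liftQ _ (LinearMap.flip ((F.kernel x).liftQ (F.metric x) le_rfl)) (by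
    intro e he
    refine LinearMap.mem_ker.2 (LinearMap.ext fun c => ?_)
    obtain ⟨e', rfl⟩ := Submodule.Quotient.mk_surjective _ c
    have h : F.metric x e e' = 0 := by
      have h1 : F.metric x e = 0 := he
      rw [h1]; rfl
    exact (F.metric_symm x e' e).trans h)

theorem transMetric_mk [IsManifold 𝓘(ℝ, EG) ∞ G] (x : M) (e e' : 𝒢.Fibre x) :
    F.transMetric x (Submodule.Quotient.mk e) (Submodule.Quotient.mk e') = F.metric x e e' :=
  F.metric_symm x e' e

/-- Smoothness of a section of the quotient bundle `E / K^F`: near every point it is the coset of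
a smooth section of `E`. -/
def IsSmoothTransSection [IsManifold 𝓘(ℝ, EG) ∞ G] (σ : ∀ x, F.TransFibre x) : Prop :=
  ∀ x₀, ∃ Y, 𝒢.IsSmoothSection Y ∧ ∀ᶠ x in 𝓝 x₀, σ x = F.coset Y x

/-- `F` is regular: `K^F` has constant rank. -/
def IsRegular : Prop :=
  ∀ x y, Module.finrank ℝ (F.kernel x) = Module.finrank ℝ (F.kernel y)

/-- A Koszul contrast function: a regular contrast function such that `X^L Y^L Z^R F |_M = 0` and
`X^L Y^L Z^R F^* |_M = 0` for all sections `X`, `Y` of `E` and all sections `Z` of `K^F`. -/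
structure IsKoszul [IsManifold 𝓘(ℝ, EG) ∞ G] : Prop where
  regular : F.IsRegular
  thirdDeriv_eq_zero : ∀ X Y Z, 𝒢.IsSmoothSection X → 𝒢.IsSmoothSection Y →
    𝒢.IsSmoothSection Z → (∀ x, Z x ∈ F.kernel x) → ∀ x, 𝒢.thirdDeriv F.toFun X Y Z x = 0
  thirdDeriv_star_eq_zero : ∀ X Y Z, 𝒢.IsSmoothSection X → 𝒢.IsSmoothSection Y →
    𝒢.IsSmoothSection Z → (∀ x, Z x ∈ F.kernel x) → ∀ x, 𝒢.thirdDeriv F.star.toFun X Y Z x = 0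

/-- The section `D` of `E / K^F` with `g^{[F]}(D, Z̄) = X^L Y^L Z^R Φ |_M` for all smooth sections
`Z` of `E`; an arbitrary value is taken at points where this does not have a solution. -/
def koszulOp [IsManifold 𝓘(ℝ, EG) ∞ G] (Φ : G → ℝ) (X Y : ∀ x, 𝒢.Fibre x) (x : M) :
    F.TransFibre x :=
  Classical.epsilon fun d => ∀ Z, 𝒢.IsSmoothSection Z →
    F.transMetric x d (F.coset Z x) = 𝒢.thirdDeriv Φ X Y Z x

/-- `∇^F_X Y`, a section of `E / K^F`. -/
def nabla [IsManifold 𝓘(ℝ, EG) ∞ G] (X Y : ∀ x, 𝒢.Fibre x) : ∀ x, F.TransFibre x :=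
  F.koszulOp F.toFun X Y

/-- `∇^{F^*}_X Y`, a section of `E / K^F`. -/
def nablaStar [IsManifold 𝓘(ℝ, EG) ∞ G] (X Y : ∀ x, 𝒢.Fibre x) : ∀ x, F.TransFibre x :=
  F.koszulOp F.star.toFun X Y

/-- The operator on sections of `E / K^F` induced by an operator `D` from sections of `E` to
sections of `E / K^F`: the value of `σ` at `x` is `(D Y) x`, where `Y` is a smooth section of `E`
whose coset is `σ` near `x`. -/
def inducedOp [IsManifold 𝓘(ℝ, EG) ∞ G]
    (D : (∀ x, 𝒢.Fibre x) → ∀ x, F.TransFibre x) (σ : ∀ x, F.TransFibre x) (x : M) :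
    F.TransFibre x :=
  Classical.epsilon fun d => ∃ Y, 𝒢.IsSmoothSection Y ∧ (∀ᶠ y in 𝓝 x, σ y = F.coset Y y) ∧
    d = D Y x

/-- `∇^{[F]}_X`, the operator on sections of `E / K^F` induced by `∇^F_X`. -/
def transNabla [IsManifold 𝓘(ℝ, EG) ∞ G] (X : ∀ x, 𝒢.Fibre x) (σ : ∀ x, F.TransFibre x) :
    ∀ x, F.TransFibre x :=
  F.inducedOp (F.nabla X) σ

/-- `∇^{[F^*]}_X`, the operator on sections of `E / K^F` induced by `∇^{F^*}_X`. -/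
def transNablaStar [IsManifold 𝓘(ℝ, EG) ∞ G] (X : ∀ x, 𝒢.Fibre x) (σ : ∀ x, F.TransFibre x) :
    ∀ x, F.TransFibre x :=
  F.inducedOp (F.nablaStar X) σ

end ContrastFunction
end LieGroupoid
end

/-! The duality comes from a single function on the groupoid. Put u = Y^L Z^R F. Along M it equals
g^F(Y,Z), because Y^L and Z^R represent Y and Z. Inversion carries X^L to -X^R and X^R to -X^L,
hence X^L Z^L Y^R F^* = -X^R Z^R Y^L F along M, and since left- and right-invariant fields commute,
the right side is -X^R u. Thus X^L Y^L Z^R F + X^L Z^L Y^R F^* = (X^L - X^R) u along M, where X^L -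
X^R is tangent to M and equals α(X). This is `thirdDeriv_add_thirdDeriv_star`; it needs no Koszul
condition.

The Koszul condition turns the third derivatives into sections of E/K^F. If Z vanishes at x, then
Z^R vanishes on the target fibre over x, to which X^L and Y^L are tangent; so X^L Y^L Z^R F is
tensorial in Z. By constant rank every element of K^F extends to a section of K^F
(`IsRegular.exists_section_kernel`), so this 1-form kills K^F pointwise and is represented by the
nondegenerate g^[F]. A local frame complementary to K^F, with invertible Gram matrix
(`IsRegular.exists_frame`), gives a smooth representative.

Descent in Y is the duality read backwards. If Y lies in K^F near x, then g^F(Y,Z) = 0 there and the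
Koszul condition for F^* kills X^L Z^L Y^R F^*, so X^L Y^L Z^R F vanishes at x; the same holds with
F and F^* interchanged.

Invariant fields are handled through curves: the value at g is the velocity of r ↦ g·c(r), for a
curve c in a target fibre. Submersion charts provide such curves and extend the multiplication
smoothly off the composable pairs. Right-invariant statements are left-invariant ones for the
opposite groupoid. -/

/-! ### Retractions onto the fibres of a submersion, and velocities of curves -/

section Submersion

variable {EM : Type*} [NormedAddCommGroup EM] [NormedSpace ℝ EM]
  {M : Type*} [TopologicalSpace M] [ChartedSpace EM M]
  {EG : Type*} [NormedAddCommGroup EG] [NormedSpace ℝ EG]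
  {G : Type*} [TopologicalSpace G] [ChartedSpace EG G]

/-- Near a point of its source, a submersion `f` admits a smooth family of local retractions of the
source onto the fibres of `f`. -/
theorem Manifold.IsSubmersionAt.exists_retraction {f : G → M} {g₀ : G}
    (hf : Manifold.IsSubmersionAt 𝓘(ℝ, EG) 𝓘(ℝ, EM) ∞ f g₀) :
    ∃ (Ω : Set (M × G)) (R : M × G → G), IsOpen Ω ∧ (f g₀, g₀) ∈ Ω ∧
      ContMDiffOn (𝓘(ℝ, EM).prod 𝓘(ℝ, EG)) 𝓘(ℝ, EG) ∞ R Ω ∧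
      (∀ p ∈ Ω, f (R p) = p.1) ∧ ∀ h, (f h, h) ∈ Ω → R (f h, h) = h := by
  set φ := hf.domChart
  set ψ := hf.codChart
  set A := hf.equiv
  have hloc : ∀ u ∈ φ.target, ψ (f (φ.symm u)) = (A u).1 := fun u hu =>
    hf.writtenInCharts (by simpa using hu)
  have hsrc : ∀ g ∈ φ.source, f g ∈ ψ.source := hf.source_subset_preimage_source
  have hφ := contMDiffOn_of_mem_maximalAtlas hf.domChart_mem_maximalAtlas
  have hψ := contMDiffOn_of_mem_maximalAtlas hf.codChart_mem_maximalAtlas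
  have hφs := contMDiffOn_symm_of_mem_maximalAtlas hf.domChart_mem_maximalAtlas
  set W : Set (M × G) := ψ.source ×ˢ φ.source
  -- In these charts `f` is the projection to the first factor; the retraction overwrites the first
  -- coordinate by that of the prescribed base point and keeps the second.
  set c : M × G → EG := fun p => A.symm (ψ p.1, (A (φ p.2)).2)
  have hWo : IsOpen W := ψ.open_source.prod φ.open_source
  have hc : ContMDiffOn (𝓘(ℝ, EM).prod 𝓘(ℝ, EG)) 𝓘(ℝ, EG) ∞ c W := by
    have h1 : ContMDiffOn (𝓘(ℝ, EM).prod 𝓘(ℝ, EG)) 𝓘(ℝ, EM) ∞ (fun p : M × G => ψ p.1) W :=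
      hψ.comp contMDiffOn_fst fun p hp => hp.1
    have h2 : ContMDiffOn (𝓘(ℝ, EM).prod 𝓘(ℝ, EG)) 𝓘(ℝ, EG) ∞ (fun p : M × G => φ p.2) W :=
      hφ.comp contMDiffOn_snd fun p hp => hp.2
    have h3 : ContMDiffOn (𝓘(ℝ, EM).prod 𝓘(ℝ, EG)) 𝓘(ℝ, EM × hf.complement) ∞
        (fun p : M × G => (ψ p.1, (A (φ p.2)).2)) W := by
      refine h1.prodMk_space ?_
      exact (((ContinuousLinearMap.snd ℝ EM hf.complement).comp
        (A : EG →L[ℝ] EM × hf.complement)).contMDiff).comp_contMDiffOn h2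
    exact (A.symm : EM × hf.complement →L[ℝ] EG).contMDiff.comp_contMDiffOn h3
  refine ⟨W ∩ c ⁻¹' φ.target, fun p => φ.symm (c p),
    hc.continuousOn.isOpen_inter_preimage hWo φ.open_target, ?_,
    hφs.comp (hc.mono Set.inter_subset_left) fun p hp => hp.2, ?_, ?_⟩
  · have h0 := hf.mem_domChart_source
    refine ⟨⟨hf.mem_codChart_source, h0⟩, ?_⟩
    have h1 := hloc (φ g₀) (φ.map_source h0)
    rw [φ.left_inv h0] at h1
    have : c (f g₀, g₀) = φ g₀ := by
      show A.symm (ψ (f g₀), _) = _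
      rw [h1]; simp
    show c (f g₀, g₀) ∈ φ.target
    rw [this]
    exact φ.map_source h0
  · rintro p ⟨hp, hp2⟩
    refine ψ.injOn (hsrc _ (φ.map_target hp2)) hp.1 ?_
    rw [hloc _ hp2]
    simp [c]
  · rintro h ⟨hp, -⟩
    have h1 := hloc (φ h) (φ.map_source hp.2)
    rw [φ.left_inv hp.2] at h1
    show φ.symm (A.symm (ψ (f h), _)) = _
    rw [h1]
    simp [φ.left_inv hp.2]

/-- The curve `c` has the velocity `w` at time `0`. -/
def HasVelocity (c : ℝ → G) (w : EG) : Prop :=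
  HasMFDerivAt 𝓘(ℝ, ℝ) 𝓘(ℝ, EG) c 0 ((1 : ℝ →L[ℝ] ℝ).smulRight w : ℝ →L[ℝ] EG)

namespace HasVelocity

theorem unique {c : ℝ → G} {w w' : EG} (h : HasVelocity c w) (h' : HasVelocity c w') :
    w = w' := by
  have := DFunLike.congr_fun (hasMFDerivAt_unique h h') (1 : ℝ)
  have h1 : (1 : ℝ) • w = (1 : ℝ) • w' := this
  simpa using h1

theorem of_eq {c : ℝ → G} {w w' : EG} (h : HasVelocity c w) (hw : w = w') : HasVelocity c w' :=
  hw ▸ h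

theorem congr {c c' : ℝ → G} {w : EG} (h : HasVelocity c w) (hc : c' =ᶠ[𝓝 0] c) :
    HasVelocity c' w :=
  HasMFDerivAt.congr_of_eventuallyEq h hc

theorem comp {c : ℝ → G} {w : EG} (h : HasVelocity c w) {f : G → M}
    {f' : EG →L[ℝ] EM} (hf : HasMFDerivAt 𝓘(ℝ, EG) 𝓘(ℝ, EM) f (c 0) f') :
    HasVelocity (EG := EM) (f ∘ c) (f' w) := by
  have h1 := HasMFDerivAt.comp (0 : ℝ) hf h
  refine h1.congr_mfderiv ?_
  exact ContinuousLinearMap.ext fun (r : ℝ) => (f'.map_smul r w)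

/-- A fibre need not determine derivatives within it uniquely, but for a curve that stays in `s` any
derivative within `s` gives the velocity of the image. -/
theorem comp_within {c : ℝ → G} {w : EG} (h : HasVelocity c w) {f : G → M} {s : Set G}
    {f' : EG →L[ℝ] EM} (hf : HasMFDerivWithinAt 𝓘(ℝ, EG) 𝓘(ℝ, EM) f s (c 0) f')
    (hs : ∀ r, c r ∈ s) : HasVelocity (EG := EM) (f ∘ c) (f' w) := by
  have h1 := HasMFDerivWithinAt.comp (0 : ℝ) hf
    ((hasMFDerivWithinAt_univ (f := c)).2 h) fun r _ => hs r
  rw [hasMFDerivWithinAt_univ] at h1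
  refine h1.congr_mfderiv ?_
  exact ContinuousLinearMap.ext fun (r : ℝ) => (f'.map_smul r w)

theorem const (g : G) : HasVelocity (fun _ => g) (0 : EG) :=
  (hasMFDerivAt_const g (0 : ℝ)).congr_mfderiv (by
    exact ContinuousLinearMap.ext fun (r : ℝ) => (smul_zero r).symm)

theorem hasDerivAt {c : ℝ → EG} {w : EG} (h : HasVelocity c w) : HasDerivAt c w 0 := by
  exact HasMFDerivAt.hasFDerivAt h

theorem prodMk {c : ℝ → G} {w : EG} (h : HasVelocity c w) {d : ℝ → M} {v : EM}
    (h' : HasVelocity d v) :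
    HasMFDerivAt 𝓘(ℝ, ℝ) (𝓘(ℝ, EG).prod 𝓘(ℝ, EM)) (fun r => (c r, d r)) 0
      ((1 : ℝ →L[ℝ] ℝ).smulRight (w, v) : ℝ →L[ℝ] EG × EM) :=
  HasMFDerivAt.prodMk h h'

end HasVelocity

theorem exists_curve [IsManifold 𝓘(ℝ, EG) ∞ G] (g : G) (w : EG) :
    ∃ c : ℝ → G, ContMDiffAt 𝓘(ℝ, ℝ) 𝓘(ℝ, EG) ∞ c 0 ∧ c 0 = g ∧ HasVelocity c w := by
  set φ := extChartAt 𝓘(ℝ, EG) g with hφ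
  let l : ℝ → EG := fun r => φ g + r • w
  have hl : ContDiff ℝ ∞ l := by fun_prop
  have hl0 : l 0 = φ g := by simp [l]
  have hsm : ContMDiffAt 𝓘(ℝ, EG) 𝓘(ℝ, EG) ∞ φ.symm (l 0) := by
    rw [hl0]
    exact (contMDiffOn_extChartAt_symm g).contMDiffAt (extChartAt_target_mem_nhds g)
  have hc : ContMDiffAt 𝓘(ℝ, ℝ) 𝓘(ℝ, EG) ∞ (φ.symm ∘ l) 0 := hsm.comp 0 hl.contMDiff.contMDiffAt
  have hc0 : (φ.symm ∘ l) 0 = g := by simp [hl0, hφ]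
  refine ⟨φ.symm ∘ l, hc, hc0, hc.continuousAt, ?_⟩
  have hd : HasDerivAt l w 0 := by
    simpa [l] using ((hasDerivAt_id (0 : ℝ)).smul_const w).const_add (φ g)
  have hev : φ ∘ φ.symm ∘ l =ᶠ[𝓝 0] l := by
    have : ∀ᶠ r in 𝓝 (0 : ℝ), l r ∈ φ.target :=
      hl.continuous.continuousAt.eventually (by rw [hl0]; exact extChartAt_target_mem_nhds g)
    filter_upwards [this] with r hr
    exact φ.right_inv hr
  simp only [writtenInExtChartAt, hc0]
  have h2 : HasFDerivAt (φ ∘ φ.symm ∘ l) ((1 : ℝ →L[ℝ] ℝ).smulRight w : ℝ →L[ℝ] EG) 0 :=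
    hd.hasFDerivAt.congr_of_eventuallyEq hev
  exact h2.hasFDerivWithinAt

/-- Take any curve with velocity `w` and retract it onto the fibre. The velocity survives because `f
∘ c` is constant to first order. -/
theorem Manifold.IsSubmersionAt.exists_curve_in_fibre [IsManifold 𝓘(ℝ, EG) ∞ G] {f : G → M} {g₀ : G}
    (hf : Manifold.IsSubmersionAt 𝓘(ℝ, EG) 𝓘(ℝ, EM) ∞ f g₀) (w : EG)
    (hw : (mfderiv 𝓘(ℝ, EG) 𝓘(ℝ, EM) f g₀ w : EM) = 0) :
    ∃ c : ℝ → G, ContMDiffAt 𝓘(ℝ, ℝ) 𝓘(ℝ, EG) ∞ c 0 ∧ c 0 = g₀ ∧ HasVelocity c w ∧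
      ∀ r, f (c r) = f g₀ := by
  classical
  obtain ⟨Ω, R, hΩ, h0, hR, hfR, hRf⟩ := hf.exists_retraction
  obtain ⟨c, hc, rfl, hcw⟩ := exists_curve g₀ w
  have hR0 : ContMDiffAt (𝓘(ℝ, EM).prod 𝓘(ℝ, EG)) 𝓘(ℝ, EG) ∞ R (f (c 0), c 0) :=
    hR.contMDiffAt (hΩ.mem_nhds h0)
  have hpair : ContMDiffAt 𝓘(ℝ, ℝ) (𝓘(ℝ, EM).prod 𝓘(ℝ, EG)) ∞ (fun r => (f (c 0), c r)) 0 :=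
    contMDiffAt_const.prodMk hc
  -- The constant value outside `Ω` keeps the curve in the fibre for all times, not only for small
  -- ones.
  set d : ℝ → G := fun r => if (f (c 0), c r) ∈ Ω then R (f (c 0), c r) else c 0
  have hd : d =ᶠ[𝓝 0] fun r => R (f (c 0), c r) := by
    filter_upwards [hpair.continuousAt.eventually (hΩ.mem_nhds h0)] with r hr
    exact if_pos hr
  have hsm : ContMDiffAt 𝓘(ℝ, ℝ) 𝓘(ℝ, EG) ∞ (fun r => R (f (c 0), c r)) 0 :=
    ContMDiffAt.comp (0 : ℝ) hR0 hpair
  refine ⟨d, hsm.congr_of_eventuallyEq hd, ?_, ?_, fun r => ?_⟩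
  · exact hd.self_of_nhds.trans (hRf _ h0)
  · have hfd := hf.contMDiffAt.mdifferentiableAt (by simp)
    set R' := mfderiv (𝓘(ℝ, EM).prod 𝓘(ℝ, EG)) 𝓘(ℝ, EG) R (f (c 0), c 0)
    have hR' : HasMFDerivAt (𝓘(ℝ, EM).prod 𝓘(ℝ, EG)) 𝓘(ℝ, EG) R (f (c 0), c 0) R' :=
      (hR0.mdifferentiableAt (by simp)).hasMFDerivAt
    have e1 := HasMFDerivAt.comp (0 : ℝ) hR' ((HasVelocity.const (f (c 0))).prodMk hcw)
    -- The curves (f (c 0), c r) and (f (c r), c r) have the same velocity, and `R` maps the second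
    -- one to `c`.
    have hfc : HasVelocity (f ∘ c) (0 : EM) := (hcw.comp hfd.hasMFDerivAt).of_eq hw
    have e2 := HasMFDerivAt.comp (0 : ℝ) hR' (hfc.prodMk hcw)
    have e3 : (R ∘ fun r => ((f ∘ c) r, c r)) =ᶠ[𝓝 0] c := by
      have hcont : ContinuousAt (fun r => (f (c r), c r)) 0 :=
        (hf.contMDiffAt.continuousAt.comp hc.continuousAt).prodMk hc.continuousAt
      filter_upwards [hcont.eventually (hΩ.mem_nhds h0)] with r hr
      exact hRf _ hr
    have e4 := hasMFDerivAt_unique (hcw.congr e3) e2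
    refine HasVelocity.congr (c := R ∘ fun r => (f (c 0), c r)) ?_ hd
    refine e1.congr_mfderiv e4.symm
  · by_cases h : (f (c 0), c r) ∈ Ω
    · simp only [d, if_pos h]; exact hfR _ h
    · simp only [d, if_neg h]

end Submersion

/-! ### The opposite groupoid, and left-invariant vector fields -/

namespace LieGroupoid

variable {EM : Type*} [NormedAddCommGroup EM] [NormedSpace ℝ EM]
  {M : Type*} [TopologicalSpace M] [ChartedSpace EM M]
  {EG : Type*} [NormedAddCommGroup EG] [NormedSpace ℝ EG]
  {G : Type*} [TopologicalSpace G] [ChartedSpace EG G]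
  (𝒢 : LieGroupoid EM M EG G)

/-- The opposite groupoid, in which source and target, hence also left- and right-invariant vector
fields, are interchanged. -/
@[reducible] def op : LieGroupoid EM M EG G where
  src := 𝒢.tgt
  tgt := 𝒢.src
  unit := 𝒢.unit
  mul g h := 𝒢.mul h g
  inv := 𝒢.inv
  isSubmersion_src := 𝒢.isSubmersion_tgt
  isSubmersion_tgt := 𝒢.isSubmersion_src
  contMDiff_unit := 𝒢.contMDiff_unit
  contMDiff_inv := 𝒢.contMDiff_inv
  contMDiffOn_mul := 𝒢.contMDiffOn_mul.comp
    (contMDiff_snd.prodMk contMDiff_fst).contMDiffOn fun _ hp => Eq.symm hp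
  src_unit := 𝒢.tgt_unit
  tgt_unit := 𝒢.src_unit
  src_mul g h e := 𝒢.tgt_mul h g e.symm
  tgt_mul g h e := 𝒢.src_mul h g e.symm
  mul_assoc g h k e e' := (𝒢.mul_assoc k h g e'.symm e.symm).symm
  unit_mul := 𝒢.mul_unit
  mul_unit := 𝒢.unit_mul
  src_inv := 𝒢.tgt_inv
  tgt_inv := 𝒢.src_inv
  mul_inv := 𝒢.inv_mul
  inv_mul := 𝒢.mul_inv

/-- By this identity every fact on left-invariant fields, applied to `𝒢.op`, yields its
right-invariant counterpart. -/
theorem rightField_eq_op (X : ∀ x, 𝒢.Fibre x) : 𝒢.rightField X = 𝒢.op.leftField X := rfl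

theorem eq_inv_of_mul_eq_unit {g h : G} (e : 𝒢.src g = 𝒢.tgt h)
    (he : 𝒢.mul g h = 𝒢.unit (𝒢.tgt g)) : h = 𝒢.inv g := by
  have h1 := 𝒢.mul_assoc (𝒢.inv g) g h (𝒢.src_inv g) e
  rw [𝒢.inv_mul, e, 𝒢.unit_mul, he, ← 𝒢.src_inv, 𝒢.mul_unit] at h1
  exact h1

theorem inv_mul_eq {g h : G} (e : 𝒢.src g = 𝒢.tgt h) :
    𝒢.inv (𝒢.mul g h) = 𝒢.mul (𝒢.inv h) (𝒢.inv g) := by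
  have e1 : 𝒢.src (𝒢.inv h) = 𝒢.tgt (𝒢.inv g) := by rw [𝒢.src_inv, 𝒢.tgt_inv, e]
  have e2 : 𝒢.src h = 𝒢.tgt (𝒢.mul (𝒢.inv h) (𝒢.inv g)) := by
    rw [𝒢.tgt_mul _ _ e1, 𝒢.tgt_inv]
  have e3 : 𝒢.mul h (𝒢.mul (𝒢.inv h) (𝒢.inv g)) = 𝒢.inv g := by
    rw [← 𝒢.mul_assoc _ _ _ (𝒢.tgt_inv h).symm e1, 𝒢.mul_inv, ← e, ← 𝒢.tgt_inv, 𝒢.unit_mul]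
  refine (𝒢.eq_inv_of_mul_eq_unit ((𝒢.src_mul _ _ e).trans e2) ?_).symm
  rw [𝒢.mul_assoc _ _ _ e e2, e3, 𝒢.mul_inv, 𝒢.tgt_mul _ _ e]

theorem contMDiff_src : ContMDiff 𝓘(ℝ, EG) 𝓘(ℝ, EM) ∞ 𝒢.src := 𝒢.isSubmersion_src.contMDiff

theorem contMDiff_tgt : ContMDiff 𝓘(ℝ, EG) 𝓘(ℝ, EM) ∞ 𝒢.tgt := 𝒢.isSubmersion_tgt.contMDiff

/-- Near a pair of composable arrows, the multiplication extends smoothly to pairs of arrows that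
need not be composable. -/
theorem exists_mul_extension {g₀ h₀ : G} (e : 𝒢.src g₀ = 𝒢.tgt h₀) :
    ∃ (U : Set (G × G)) (m : G × G → G), IsOpen U ∧ (g₀, h₀) ∈ U ∧
      ContMDiffOn (𝓘(ℝ, EG).prod 𝓘(ℝ, EG)) 𝓘(ℝ, EG) ∞ m U ∧
      ∀ p ∈ U, 𝒢.src p.1 = 𝒢.tgt p.2 → m p = 𝒢.mul p.1 p.2 := by
  obtain ⟨Ω, R, hΩ, h0, hR, htR, hRt⟩ :=
    (𝒢.isSubmersion_tgt.isSubmersionAt h₀).exists_retraction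
  have hpair : ContMDiff (𝓘(ℝ, EG).prod 𝓘(ℝ, EG)) (𝓘(ℝ, EM).prod 𝓘(ℝ, EG)) ∞
      (fun p : G × G => (𝒢.src p.1, p.2)) :=
    (𝒢.contMDiff_src.comp contMDiff_fst).prodMk contMDiff_snd
  set U := (fun p : G × G => (𝒢.src p.1, p.2)) ⁻¹' Ω
  have hRU : ContMDiffOn (𝓘(ℝ, EG).prod 𝓘(ℝ, EG)) 𝓘(ℝ, EG) ∞
      (fun p : G × G => R (𝒢.src p.1, p.2)) U :=
    hR.comp hpair.contMDiffOn fun p hp => hp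
  -- Before multiplying, the second arrow is retracted onto the target fibre over the source of the
  -- first.
  refine ⟨U, fun p => 𝒢.mul p.1 (R (𝒢.src p.1, p.2)), hΩ.preimage hpair.continuous, ?_, ?_, ?_⟩
  · show (𝒢.src g₀, h₀) ∈ Ω
    rw [e]; exact h0
  · exact 𝒢.contMDiffOn_mul.comp (contMDiffOn_fst.prodMk hRU) fun p hp => (htR _ hp).symm
  · intro p hp h
    have hp' : (𝒢.src p.1, p.2) ∈ Ω := hp
    show 𝒢.mul p.1 (R (𝒢.src p.1, p.2)) = _
    rw [h] at hp' ⊢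
    rw [hRt _ hp']

/-- This frees `leftField` from the choice hidden in `mfderivWithin` on a fibre: on vectors tangent
to the fibre the derivative is realized by curves inside it. -/
theorem hasVelocity_mul_leftField (X : ∀ x, 𝒢.Fibre x) {g : G} {x : M} (hx : 𝒢.src g = x)
    {c : ℝ → G} (hc0 : c 0 = 𝒢.unit x) (hc : HasVelocity (EG := EG) c (𝒢.leftRep x (X x)))
    (ht : ∀ r, 𝒢.tgt (c r) = x) :
    HasVelocity (EG := EG) (fun r => 𝒢.mul g (c r)) (𝒢.leftField X g) := by
  subst hx
  have h1 : ContMDiffWithinAt 𝓘(ℝ, EG) 𝓘(ℝ, EG) ∞ (fun h => 𝒢.mul g h)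
      {h | 𝒢.tgt h = 𝒢.src g} (𝒢.unit (𝒢.src g)) :=
    (𝒢.contMDiffOn_mul (g, 𝒢.unit (𝒢.src g)) (𝒢.tgt_unit _).symm).comp
      (𝒢.unit (𝒢.src g)) (contMDiffWithinAt_const.prodMk contMDiffWithinAt_id)
      fun h hh => Eq.symm hh
  have h2 : HasMFDerivWithinAt 𝓘(ℝ, EG) 𝓘(ℝ, EG) (fun h => 𝒢.mul g h)
      {h | 𝒢.tgt h = 𝒢.src g} (c 0)
      (mfderivWithin 𝓘(ℝ, EG) 𝓘(ℝ, EG) (fun h => 𝒢.mul g h) {h | 𝒢.tgt h = 𝒢.src g}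
        (𝒢.unit (𝒢.src g)) : EG →L[ℝ] EG) := by
    rw [hc0]
    exact (h1.mdifferentiableWithinAt (by simp)).hasMFDerivWithinAt
  exact hc.comp_within h2 ht

theorem hasDerivAt_fieldDeriv_leftField (X : ∀ x, 𝒢.Fibre x) {g : G} {x : M} (hx : 𝒢.src g = x)
    {c : ℝ → G} (hc0 : c 0 = 𝒢.unit x) (hc : HasVelocity (EG := EG) c (𝒢.leftRep x (X x)))
    (ht : ∀ r, 𝒢.tgt (c r) = x) {f : G → ℝ} (hf : MDifferentiableAt 𝓘(ℝ, EG) 𝓘(ℝ, ℝ) f g) :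
    HasDerivAt (fun r => f (𝒢.mul g (c r))) (fieldDeriv (𝒢.leftField X) f g) 0 := by
  have h1 := 𝒢.hasVelocity_mul_leftField X hx hc0 hc ht
  have h2 : 𝒢.mul g (c 0) = g := by rw [hc0, ← hx, 𝒢.mul_unit]
  have h3 : HasMFDerivAt 𝓘(ℝ, EG) 𝓘(ℝ, ℝ) f (𝒢.mul g (c 0))
      (mfderiv 𝓘(ℝ, EG) 𝓘(ℝ, ℝ) f g : EG →L[ℝ] ℝ) := by
    rw [h2]
    exact hf.hasMFDerivAt
  exact (h1.comp h3).hasDerivAt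

theorem leftField_eq_zero (X : ∀ x, 𝒢.Fibre x) {g : G} (h : X (𝒢.src g) = 0) :
    𝒢.leftField X g = 0 := by
  simp only [leftField, h, map_zero]
  rfl

theorem leftField_add (X Y : ∀ x, 𝒢.Fibre x) (g : G) :
    𝒢.leftField (X + Y) g = 𝒢.leftField X g + 𝒢.leftField Y g := by
  simp only [leftField, Pi.add_apply, map_add]
  rfl

theorem leftField_smul (a : ℝ) (X : ∀ x, 𝒢.Fibre x) (g : G) :
    𝒢.leftField (a • X) g = a • 𝒢.leftField X g := by
  simp only [leftField, Pi.smul_apply, map_smul]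
  rfl

theorem leftField_neg (X : ∀ x, 𝒢.Fibre x) (g : G) :
    𝒢.leftField (-X) g = -𝒢.leftField X g := by
  simp only [leftField, Pi.neg_apply, map_neg]
  rfl

variable [IsManifold 𝓘(ℝ, EG) ∞ G]

theorem exists_curve_leftRep (x : M) (e : 𝒢.Fibre x) :
    ∃ c : ℝ → G, ContMDiffAt 𝓘(ℝ, ℝ) 𝓘(ℝ, EG) ∞ c 0 ∧ c 0 = 𝒢.unit x ∧
      HasVelocity (EG := EG) c (𝒢.leftRep x e) ∧ ∀ r, 𝒢.tgt (c r) = x := by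
  obtain ⟨c, h1, h2, h3, h4⟩ := (𝒢.isSubmersion_tgt.isSubmersionAt
    (𝒢.unit x)).exists_curve_in_fibre (𝒢.leftRep x e) (𝒢.dTgt_leftRep x e)
  exact ⟨c, h1, h2, h3, fun r => (h4 r).trans (𝒢.tgt_unit x)⟩

theorem leftField_unit (X : ∀ x, 𝒢.Fibre x) (x : M) :
    (𝒢.leftField X (𝒢.unit x) : EG) = 𝒢.leftRep x (X x) := by
  obtain ⟨c, -, hc0, hc, ht⟩ := 𝒢.exists_curve_leftRep x (X x)
  refine (𝒢.hasVelocity_mul_leftField X (𝒢.src_unit x) hc0 hc ht).unique ?_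
  have : (fun r => 𝒢.mul (𝒢.unit x) (c r)) = c := funext fun r => by
    have h := 𝒢.unit_mul (c r)
    rwa [ht r] at h
  rw [this]
  exact hc

/-- A function that vanishes on a target fibre has vanishing derivatives along left-invariant vector
fields there. -/
theorem fieldDeriv_leftField_eq_zero (X : ∀ x, 𝒢.Fibre x) {u : G → ℝ} {x : M}
    (hu : ∀ g, 𝒢.tgt g = x → u g = 0) {g : G} (hg : 𝒢.tgt g = x) :
    fieldDeriv (𝒢.leftField X) u g = 0 := by
  -- Where `u` is not differentiable, `mfderiv` is zero by convention, so no smoothness of `u` is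
  -- needed.
  by_cases hd : MDifferentiableAt 𝓘(ℝ, EG) 𝓘(ℝ, ℝ) u g
  · obtain ⟨c, -, hc0, hc, ht⟩ := 𝒢.exists_curve_leftRep (𝒢.src g) (X (𝒢.src g))
    refine (𝒢.hasDerivAt_fieldDeriv_leftField X rfl hc0 hc ht hd).unique ?_
    have : (fun r => u (𝒢.mul g (c r))) = fun _ => 0 :=
      funext fun r => hu _ (by rw [𝒢.tgt_mul _ _ (ht r).symm, hg])
    rw [this]
    exact hasDerivAt_const _ _
  · rw [fieldDeriv, mfderiv_zero_of_not_mdifferentiableAt hd]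
    rfl

/-- A left-invariant vector field is smooth. -/
theorem contMDiff_leftField {X : ∀ x, 𝒢.Fibre x} (hX : 𝒢.IsSmoothSection X) :
    ContMDiff 𝓘(ℝ, EG) 𝓘(ℝ, EG).tangent ∞
      (fun g => (⟨g, 𝒢.leftField X g⟩ : TangentBundle 𝓘(ℝ, EG) G)) := by
  intro g₀
  obtain ⟨U, m, hU, h0, hm, hmul⟩ :=
    𝒢.exists_mul_extension (g₀ := g₀) (h₀ := 𝒢.unit (𝒢.src g₀)) (𝒢.tgt_unit _).symm
  -- Near `g₀` the left-invariant field is the tangent map of the extended multiplication applied to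
  -- the smooth section (0_g, X^L at the unit of the source of g).
  let σ : G → TangentBundle (𝓘(ℝ, EG).prod 𝓘(ℝ, EG)) (G × G) := fun g =>
    (equivTangentBundleProd 𝓘(ℝ, EG) G 𝓘(ℝ, EG) G).symm
      (⟨g, 0⟩, ⟨𝒢.unit (𝒢.src g), 𝒢.leftRep (𝒢.src g) (X (𝒢.src g))⟩)
  have hσ : ContMDiff 𝓘(ℝ, EG) (𝓘(ℝ, EG).prod 𝓘(ℝ, EG)).tangent ∞ σ := by
    have h1 : ContMDiff 𝓘(ℝ, EG) 𝓘(ℝ, EG).tangent ∞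
        (fun g => (⟨g, 0⟩ : TangentBundle 𝓘(ℝ, EG) G)) :=
      Bundle.contMDiff_zeroSection ℝ (TangentSpace 𝓘(ℝ, EG) : G → Type _)
    exact contMDiff_equivTangentBundleProd_symm.comp
      (h1.prodMk (hX.comp 𝒢.contMDiff_src))
  have hT := hm.contMDiffOn_tangentMapWithin (m := ∞) le_rfl hU.uniqueMDiffOn
  have hp : Continuous fun g => (g, 𝒢.unit (𝒢.src g)) :=
    continuous_id.prodMk (𝒢.contMDiff_unit.continuous.comp 𝒢.contMDiff_src.continuous)
  have hev : ∀ᶠ g in 𝓝 g₀, (g, 𝒢.unit (𝒢.src g)) ∈ U :=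
    hp.continuousAt.eventually (hU.mem_nhds h0)
  have hcomp : ContMDiffAt 𝓘(ℝ, EG) 𝓘(ℝ, EG).tangent ∞
      (tangentMapWithin (𝓘(ℝ, EG).prod 𝓘(ℝ, EG)) 𝓘(ℝ, EG) m U ∘ σ) g₀ := by
    refine ContMDiffAt.comp g₀ (hT.contMDiffAt ?_) hσ.contMDiffAt
    exact (hU.preimage (FiberBundle.continuous_proj _ _)).mem_nhds h0
  refine hcomp.congr_of_eventuallyEq ?_
  filter_upwards [hev] with g hg
  have hmg : m (g, 𝒢.unit (𝒢.src g)) = g := by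
    rw [hmul _ hg (𝒢.tgt_unit _).symm, 𝒢.mul_unit]
  obtain ⟨c, hcs, hc0, hc, ht⟩ := 𝒢.exists_curve_leftRep (𝒢.src g) (X (𝒢.src g))
  have h1 := 𝒢.hasVelocity_mul_leftField X rfl hc0 hc ht
  have hmd : HasMFDerivAt (𝓘(ℝ, EG).prod 𝓘(ℝ, EG)) 𝓘(ℝ, EG) m (g, c 0)
      (mfderivWithin (𝓘(ℝ, EG).prod 𝓘(ℝ, EG)) 𝓘(ℝ, EG) m U (g, 𝒢.unit (𝒢.src g)) :
        EG × EG →L[ℝ] EG) := by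
    rw [hc0, mfderivWithin_of_isOpen hU hg]
    exact ((hm.contMDiffAt (hU.mem_nhds hg)).mdifferentiableAt (by simp)).hasMFDerivAt
  have h2 := HasMFDerivAt.comp (0 : ℝ) hmd ((HasVelocity.const g).prodMk hc)
  have h3 : (m ∘ fun r => (g, c r)) =ᶠ[𝓝 0] fun r => 𝒢.mul g (c r) := by
    have hcc : ContinuousAt (fun r => (g, c r)) 0 := continuousAt_const.prodMk hcs.continuousAt
    filter_upwards [hcc.eventually (hU.mem_nhds (by show (g, c 0) ∈ U; rw [hc0]; exact hg))] with r hr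
    exact hmul _ hr (ht r).symm
  -- Both sides are the velocity of the curve r ↦ g·c(r).
  have h4 : (mfderivWithin (𝓘(ℝ, EG).prod 𝓘(ℝ, EG)) 𝓘(ℝ, EG) m U (g, 𝒢.unit (𝒢.src g)) :
        EG × EG →L[ℝ] EG) (0, 𝒢.leftRep (𝒢.src g) (X (𝒢.src g))) = 𝒢.leftField X g := by
    refine HasVelocity.unique (EG := EG) (c := m ∘ fun r => (g, c r)) ?_ (h1.congr h3)
    exact h2.congr_mfderiv (ContinuousLinearMap.ext fun (r : ℝ) =>
      ContinuousLinearMap.map_smul _ r _)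
  have key : ∀ (g' : G) (w : EG), g' = g → w = 𝒢.leftField X g →
      (⟨g, 𝒢.leftField X g⟩ : TangentBundle 𝓘(ℝ, EG) G) = ⟨g', w⟩ := by
    rintro _ _ rfl rfl; rfl
  exact key _ _ hmg h4

end LieGroupoid

/-! ### Smooth vector fields along a map, and smooth sections of the Lie algebroid -/

section Along

variable {EM : Type*} [NormedAddCommGroup EM] [NormedSpace ℝ EM]
  {M : Type*} [TopologicalSpace M] [ChartedSpace EM M]
  {EG : Type*} [NormedAddCommGroup EG] [NormedSpace ℝ EG]
  {G : Type*} [TopologicalSpace G] [ChartedSpace EG G] [IsManifold 𝓘(ℝ, EG) ∞ G]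
  {f : M → G} {v w : ∀ x, TangentSpace 𝓘(ℝ, EG) (f x)} {x₀ : M}

/-- The trivialization at `f x₀` is linear on fibres, so the sum is computed on vector-valued
functions. -/
theorem ContMDiffAt.add_along
    (hv : ContMDiffAt 𝓘(ℝ, EM) 𝓘(ℝ, EG).tangent ∞
      (fun x => (⟨f x, v x⟩ : TangentBundle 𝓘(ℝ, EG) G)) x₀)
    (hw : ContMDiffAt 𝓘(ℝ, EM) 𝓘(ℝ, EG).tangent ∞
      (fun x => (⟨f x, w x⟩ : TangentBundle 𝓘(ℝ, EG) G)) x₀) :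
    ContMDiffAt 𝓘(ℝ, EM) 𝓘(ℝ, EG).tangent ∞
      (fun x => (⟨f x, v x + w x⟩ : TangentBundle 𝓘(ℝ, EG) G)) x₀ := by
  rw [Bundle.contMDiffAt_totalSpace] at hv hw ⊢
  refine ⟨hv.1, (hv.2.add hw.2).congr_of_eventuallyEq ?_⟩
  set e := trivializationAt EG (TangentSpace 𝓘(ℝ, EG)) (f x₀)
  filter_upwards [hv.1.continuousAt.eventually (e.open_baseSet.mem_nhds
    (FiberBundle.mem_baseSet_trivializationAt' (f x₀)))] with x hx
  exact (e.linear ℝ hx).1 _ _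

theorem ContMDiffAt.smul_along {a : M → ℝ} (ha : ContMDiffAt 𝓘(ℝ, EM) 𝓘(ℝ, ℝ) ∞ a x₀)
    (hv : ContMDiffAt 𝓘(ℝ, EM) 𝓘(ℝ, EG).tangent ∞
      (fun x => (⟨f x, v x⟩ : TangentBundle 𝓘(ℝ, EG) G)) x₀) :
    ContMDiffAt 𝓘(ℝ, EM) 𝓘(ℝ, EG).tangent ∞
      (fun x => (⟨f x, a x • v x⟩ : TangentBundle 𝓘(ℝ, EG) G)) x₀ := by
  rw [Bundle.contMDiffAt_totalSpace] at hv ⊢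
  refine ⟨hv.1, (ha.smul hv.2).congr_of_eventuallyEq ?_⟩
  set e := trivializationAt EG (TangentSpace 𝓘(ℝ, EG)) (f x₀)
  filter_upwards [hv.1.continuousAt.eventually (e.open_baseSet.mem_nhds
    (FiberBundle.mem_baseSet_trivializationAt' (f x₀)))] with x hx
  exact (e.linear ℝ hx).2 _ _

end Along

namespace LieGroupoid

variable {EM : Type*} [NormedAddCommGroup EM] [NormedSpace ℝ EM]
  {M : Type*} [TopologicalSpace M] [ChartedSpace EM M]
  {EG : Type*} [NormedAddCommGroup EG] [NormedSpace ℝ EG]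
  {G : Type*} [TopologicalSpace G] [ChartedSpace EG G]
  {𝒢 : LieGroupoid EM M EG G}

theorem leftRep_mk (x : M) (v : TangentSpace 𝓘(ℝ, EG) (𝒢.unit x)) :
    𝒢.leftRep x (Submodule.Quotient.mk v) = v - 𝒢.dUnit x (𝒢.dTgt x v) := rfl

variable [IsManifold 𝓘(ℝ, EG) ∞ G]

theorem contMDiff_dUnit_dTgt [IsManifold 𝓘(ℝ, EM) ∞ M]
    {v : ∀ x, TangentSpace 𝓘(ℝ, EG) (𝒢.unit x)}
    (hv : ContMDiff 𝓘(ℝ, EM) 𝓘(ℝ, EG).tangent ∞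
      (fun x => (⟨𝒢.unit x, v x⟩ : TangentBundle 𝓘(ℝ, EG) G))) :
    ContMDiff 𝓘(ℝ, EM) 𝓘(ℝ, EG).tangent ∞
      (fun x => (⟨𝒢.unit x, 𝒢.dUnit x (𝒢.dTgt x (v x))⟩ : TangentBundle 𝓘(ℝ, EG) G)) := by
  have h1 := (𝒢.contMDiff_unit.contMDiff_tangentMap (m := ∞) le_rfl).comp
    ((𝒢.contMDiff_tgt.contMDiff_tangentMap (m := ∞) le_rfl).comp hv)
  refine h1.congr fun x => ?_
  -- The tangent map of the target lands over `tgt (unit x)`, which equals `x` only propositionally.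
  have key : ∀ (y : M) (w : EM), y = x →
      (⟨𝒢.unit x, 𝒢.dUnit x w⟩ : TangentBundle 𝓘(ℝ, EG) G) =
        tangentMap 𝓘(ℝ, EM) 𝓘(ℝ, EG) 𝒢.unit ⟨y, w⟩ := by
    rintro _ w rfl; rfl
  exact key _ _ (𝒢.tgt_unit x)

/-- The cosets of a vector field along the units form a smooth section of the Lie algebroid. -/
theorem isSmoothSection_mk [IsManifold 𝓘(ℝ, EM) ∞ M]
    {v : ∀ x, TangentSpace 𝓘(ℝ, EG) (𝒢.unit x)}
    (hv : ContMDiff 𝓘(ℝ, EM) 𝓘(ℝ, EG).tangent ∞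
      (fun x => (⟨𝒢.unit x, v x⟩ : TangentBundle 𝓘(ℝ, EG) G))) :
    𝒢.IsSmoothSection fun x => Submodule.Quotient.mk (v x) := by
  intro x
  have h1 := (hv x).add_along ((contMDiffAt_const (c := (-1 : ℝ))).smul_along
    (contMDiff_dUnit_dTgt hv x))
  refine h1.congr_of_eventuallyEq (Filter.Eventually.of_forall fun y => ?_)
  simp only [leftRep_mk, sub_eq_add_neg, neg_one_smul]

namespace IsSmoothSection

variable {X Y : ∀ x, 𝒢.Fibre x}

/-- Smoothness is defined by the representative tangent to target fibres. That representative is a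
smooth field along the units, so its projection to the source fibres is smooth too. -/
theorem op [IsManifold 𝓘(ℝ, EM) ∞ M] (hX : 𝒢.IsSmoothSection X) : 𝒢.op.IsSmoothSection X := by
  have h1 := isSmoothSection_mk (𝒢 := 𝒢.op) hX
  have h2 : (fun x => Submodule.Quotient.mk (𝒢.leftRep x (X x)) : ∀ x, 𝒢.op.Fibre x) = X :=
    funext fun x => 𝒢.mk_leftRep x (X x)
  rwa [h2] at h1

theorem add (hX : 𝒢.IsSmoothSection X) (hY : 𝒢.IsSmoothSection Y) :
    𝒢.IsSmoothSection (X + Y) := fun x => by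
  simpa only [Pi.add_apply, map_add] using (hX x).add_along (hY x)

theorem smul {a : M → ℝ} (ha : ContMDiff 𝓘(ℝ, EM) 𝓘(ℝ, ℝ) ∞ a) (hX : 𝒢.IsSmoothSection X) :
    𝒢.IsSmoothSection fun x => a x • X x := fun x => by
  simpa only [map_smul] using (ha x).smul_along (hX x)

theorem neg (hX : 𝒢.IsSmoothSection X) : 𝒢.IsSmoothSection (-X) := by
  have := smul (contMDiff_const (c := (-1 : ℝ))) hX
  simp only [neg_one_smul] at this
  exact this

theorem sub (hX : 𝒢.IsSmoothSection X) (hY : 𝒢.IsSmoothSection Y) :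
    𝒢.IsSmoothSection (X - Y) := by
  rw [sub_eq_add_neg]
  exact hX.add hY.neg

theorem zero : 𝒢.IsSmoothSection 0 := by
  intro x
  have h : ContMDiff 𝓘(ℝ, EM) 𝓘(ℝ, EG).tangent ∞
      (fun x => (⟨𝒢.unit x, 0⟩ : TangentBundle 𝓘(ℝ, EG) G)) :=
    (Bundle.contMDiff_zeroSection ℝ (TangentSpace 𝓘(ℝ, EG) : G → Type _)).comp 𝒢.contMDiff_unit
  simpa only [Pi.zero_apply, map_zero] using h x

theorem sum {ι : Type*} (s : Finset ι) {a : ι → M → ℝ} {X : ι → ∀ x, 𝒢.Fibre x}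
    (ha : ∀ i, ContMDiff 𝓘(ℝ, EM) 𝓘(ℝ, ℝ) ∞ (a i)) (hX : ∀ i, 𝒢.IsSmoothSection (X i)) :
    𝒢.IsSmoothSection fun x => ∑ i ∈ s, a i x • X i x := by
  classical
  induction s using Finset.induction_on with
  | empty => exact zero
  | insert i s hi ih =>
    simp only [Finset.sum_insert hi]
    exact (smul (ha i) (hX i)).add ih

end IsSmoothSection

/-- Through every element of the Lie algebroid passes a global smooth section. -/
theorem exists_isSmoothSection_apply_eq [FiniteDimensional ℝ EM] [IsManifold 𝓘(ℝ, EM) ∞ M]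
    [T2Space M] (𝒢 : LieGroupoid EM M EG G) (x₀ : M) (e : 𝒢.Fibre x₀) :
    ∃ Z, 𝒢.IsSmoothSection Z ∧ Z x₀ = e := by
  obtain ⟨v₀, rfl⟩ := Submodule.Quotient.mk_surjective _ e
  set t := trivializationAt EG (TangentSpace 𝓘(ℝ, EG)) (𝒢.unit x₀)
  have hx₀ : 𝒢.unit x₀ ∈ t.baseSet := FiberBundle.mem_baseSet_trivializationAt' _
  set V : Set M := 𝒢.unit ⁻¹' t.baseSet
  have hVo : IsOpen V := t.open_baseSet.preimage 𝒢.contMDiff_unit.continuous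
  -- The local extension is constant in a trivialization; a bump function then makes it global.
  let v : ∀ x, TangentSpace 𝓘(ℝ, EG) (𝒢.unit x) := fun x => t.symm (𝒢.unit x) v₀
  have hv : ∀ x ∈ V, ContMDiffAt 𝓘(ℝ, EM) 𝓘(ℝ, EG).tangent ∞
      (fun x => (⟨𝒢.unit x, v x⟩ : TangentBundle 𝓘(ℝ, EG) G)) x := by
    intro x hx
    have h1 : ContMDiffAt 𝓘(ℝ, EM) 𝓘(ℝ, EG).tangent ∞
        (fun x => t.toOpenPartialHomeomorph.symm (𝒢.unit x, v₀)) x := by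
      refine ((Bundle.Trivialization.contMDiffOn_symm (n := ∞) (IB := 𝓘(ℝ, EG)) t).contMDiffAt
        (t.open_target.mem_nhds ?_)).comp x
        ((𝒢.contMDiff_unit x).prodMk contMDiffAt_const)
      exact t.mem_target.2 hx
    refine h1.congr_of_eventuallyEq ?_
    filter_upwards [hVo.mem_nhds hx] with y hy
    exact t.mk_symm hy v₀
  obtain ⟨ψ, -, hψ⟩ := (SmoothBumpFunction.nhds_basis_tsupport (I := 𝓘(ℝ, EM)) x₀).mem_iff.1
    (hVo.mem_nhds hx₀)
  have hψv : ContMDiff 𝓘(ℝ, EM) 𝓘(ℝ, EG).tangent ∞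
      (fun x => (⟨𝒢.unit x, ψ x • v x⟩ : TangentBundle 𝓘(ℝ, EG) G)) := by
    intro x
    by_cases hx : x ∈ tsupport ψ
    · exact ψ.contMDiffAt.smul_along (hv x (hψ hx))
    · have h : ContMDiff 𝓘(ℝ, EM) 𝓘(ℝ, EG).tangent ∞
          (fun x => (⟨𝒢.unit x, 0⟩ : TangentBundle 𝓘(ℝ, EG) G)) :=
        (Bundle.contMDiff_zeroSection ℝ (TangentSpace 𝓘(ℝ, EG) : G → Type _)).comp
          𝒢.contMDiff_unit
      refine (h x).congr_of_eventuallyEq ?_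
      filter_upwards [notMem_tsupport_iff_eventuallyEq.1 hx] with y hy
      simp [hy]
  refine ⟨_, isSmoothSection_mk hψv, ?_⟩
  have h1 : v x₀ = v₀ := by
    have h2 : (t ⟨𝒢.unit x₀, v₀⟩).2 = v₀ :=
      tangentCoordChange_self (I := 𝓘(ℝ, EG)) (mem_extChartAt_source (𝒢.unit x₀))
    have h3 := t.symm_apply_apply_mk hx₀ v₀
    rwa [h2] at h3
  show Submodule.Quotient.mk (ψ x₀ • v x₀) = _
  rw [ψ.eq_one, h1, one_smul]

end LieGroupoid

/-! ### Derivatives along invariant fields, and commutation of left and right -/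

/-- Mixed second partial derivatives commute. -/
theorem deriv_deriv_comm {Ψ : ℝ × ℝ → ℝ} (h : ContDiffAt ℝ 2 Ψ 0) :
    deriv (fun s => deriv (fun r => Ψ (r, s)) 0) 0 =
      deriv (fun r => deriv (fun s => Ψ (r, s)) 0) 0 := by
  have hd : ∀ᶠ p in 𝓝 (0 : ℝ × ℝ), DifferentiableAt ℝ Ψ p := by
    filter_upwards [h.eventually (by simp)] with p hp
    exact hp.differentiableAt (by simp)
  have hd2 : HasFDerivAt (fderiv ℝ Ψ) (fderiv ℝ (fderiv ℝ Ψ) 0) ((0 : ℝ), (0 : ℝ)) :=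
    ((h.fderiv_right (m := 1) (by norm_num)).differentiableAt (by simp)).hasFDerivAt
  have c1 : ∀ s : ℝ, HasDerivAt (fun r : ℝ => (r, s)) (1, 0) 0 := fun s =>
    (hasDerivAt_id _).prodMk (hasDerivAt_const _ _)
  have c2 : ∀ r : ℝ, HasDerivAt (fun s : ℝ => (r, s)) (0, 1) 0 := fun r =>
    (hasDerivAt_const _ _).prodMk (hasDerivAt_id _)
  have e1 : (fun s => deriv (fun r => Ψ (r, s)) 0) =ᶠ[𝓝 0]
      fun s => fderiv ℝ Ψ (0, s) (1, 0) := by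
    filter_upwards [(c2 0).continuousAt.eventually hd] with s hs
    exact (hs.hasFDerivAt.comp_hasDerivAt (0 : ℝ) (c1 s)).deriv
  have e2 : (fun r => deriv (fun s => Ψ (r, s)) 0) =ᶠ[𝓝 0]
      fun r => fderiv ℝ Ψ (r, 0) (0, 1) := by
    filter_upwards [(c1 0).continuousAt.eventually hd] with r hr
    exact (hr.hasFDerivAt.comp_hasDerivAt (0 : ℝ) (c2 r)).deriv
  have e3 := ((hd2.comp_hasDerivAt (0 : ℝ) (c2 0)).clm_apply
    (hasDerivAt_const (0 : ℝ) ((1 : ℝ), (0 : ℝ)))).deriv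
  have e4 := ((HasFDerivAt.comp_hasDerivAt (f := fun r : ℝ => (r, (0 : ℝ))) (0 : ℝ) hd2 (c1 0)).clm_apply
    (hasDerivAt_const (0 : ℝ) ((0 : ℝ), (1 : ℝ)))).deriv
  rw [e1.deriv_eq, e2.deriv_eq]
  refine e3.trans (Eq.trans ?_ e4.symm)
  have := (h.isSymmSndFDerivAt (by simp)) (0, 1) (1, 0)
  simpa using this

namespace LieGroupoid

variable {EM : Type*} [NormedAddCommGroup EM] [NormedSpace ℝ EM]
  {M : Type*} [TopologicalSpace M] [ChartedSpace EM M]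
  {EG : Type*} [NormedAddCommGroup EG] [NormedSpace ℝ EG]
  {G : Type*} [TopologicalSpace G] [ChartedSpace EG G]

section FieldDeriv

variable {V : ∀ g : G, TangentSpace 𝓘(ℝ, EG) g} {f u : G → ℝ} {g : G}

theorem fieldDeriv_add_field (V W : ∀ g : G, TangentSpace 𝓘(ℝ, EG) g) (f : G → ℝ) (g : G) :
    fieldDeriv (fun g => V g + W g) f g = fieldDeriv V f g + fieldDeriv W f g :=
  map_add (mfderiv 𝓘(ℝ, EG) 𝓘(ℝ, ℝ) f g) _ _

theorem fieldDeriv_smul_field (a : ℝ) (V : ∀ g : G, TangentSpace 𝓘(ℝ, EG) g) (f : G → ℝ) (g : G) :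
    fieldDeriv (fun g => a • V g) f g = a * fieldDeriv V f g :=
  map_smul (mfderiv 𝓘(ℝ, EG) 𝓘(ℝ, ℝ) f g) a _

theorem fieldDeriv_add (V : ∀ g : G, TangentSpace 𝓘(ℝ, EG) g)
    (hf : MDifferentiableAt 𝓘(ℝ, EG) 𝓘(ℝ, ℝ) f g)
    (hu : MDifferentiableAt 𝓘(ℝ, EG) 𝓘(ℝ, ℝ) u g) :
    fieldDeriv V (fun g => f g + u g) g = fieldDeriv V f g + fieldDeriv V u g :=
  DFunLike.congr_fun (hf.hasMFDerivAt.add hu.hasMFDerivAt).mfderiv (V g)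

theorem fieldDeriv_const_mul (V : ∀ g : G, TangentSpace 𝓘(ℝ, EG) g) (a : ℝ)
    (hf : MDifferentiableAt 𝓘(ℝ, EG) 𝓘(ℝ, ℝ) f g) :
    fieldDeriv V (fun g => a * f g) g = a * fieldDeriv V f g :=
  DFunLike.congr_fun (hf.hasMFDerivAt.const_smul a).mfderiv (V g)

theorem contMDiff_fieldDeriv [IsManifold 𝓘(ℝ, EG) ∞ G]
    (hV : ContMDiff 𝓘(ℝ, EG) 𝓘(ℝ, EG).tangent ∞
      (fun g => (⟨g, V g⟩ : TangentBundle 𝓘(ℝ, EG) G)))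
    (hf : ContMDiff 𝓘(ℝ, EG) 𝓘(ℝ, ℝ) ∞ f) :
    ContMDiff 𝓘(ℝ, EG) 𝓘(ℝ, ℝ) ∞ (fieldDeriv V f) :=
  (contMDiff_snd_tangentBundle_modelSpace ℝ 𝓘(ℝ, ℝ)).comp
    ((hf.contMDiff_tangentMap (m := ∞) le_rfl).comp hV)

end FieldDeriv

variable {𝒢 : LieGroupoid EM M EG G} {X Y Z : ∀ x, 𝒢.Fibre x} {f : G → ℝ}

variable [IsManifold 𝓘(ℝ, EG) ∞ G]

theorem contMDiff_fieldDeriv_leftField (hX : 𝒢.IsSmoothSection X)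
    (hf : ContMDiff 𝓘(ℝ, EG) 𝓘(ℝ, ℝ) ∞ f) :
    ContMDiff 𝓘(ℝ, EG) 𝓘(ℝ, ℝ) ∞ (fieldDeriv (𝒢.leftField X) f) :=
  contMDiff_fieldDeriv (𝒢.contMDiff_leftField hX) hf

theorem rightField_unit (𝒢 : LieGroupoid EM M EG G) (X : ∀ x, 𝒢.Fibre x) (x : M) :
    (𝒢.rightField X (𝒢.unit x) : EG) = 𝒢.rightRep x (X x) :=
  𝒢.op.leftField_unit X x

variable [IsManifold 𝓘(ℝ, EM) ∞ M]

theorem contMDiff_rightField (hX : 𝒢.IsSmoothSection X) :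
    ContMDiff 𝓘(ℝ, EG) 𝓘(ℝ, EG).tangent ∞
      (fun g => (⟨g, 𝒢.rightField X g⟩ : TangentBundle 𝓘(ℝ, EG) G)) :=
  𝒢.op.contMDiff_leftField hX.op

theorem contMDiff_fieldDeriv_rightField (hX : 𝒢.IsSmoothSection X)
    (hf : ContMDiff 𝓘(ℝ, EG) 𝓘(ℝ, ℝ) ∞ f) :
    ContMDiff 𝓘(ℝ, EG) 𝓘(ℝ, ℝ) ∞ (fieldDeriv (𝒢.rightField X) f) :=
  contMDiff_fieldDeriv (contMDiff_rightField hX) hf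

/-- Left- and right-invariant vector fields commute. -/
theorem fieldDeriv_leftField_rightField_comm (hX : 𝒢.IsSmoothSection X)
    (hZ : 𝒢.IsSmoothSection Z) (hf : ContMDiff 𝓘(ℝ, EG) 𝓘(ℝ, ℝ) ∞ f) :
    fieldDeriv (𝒢.leftField X) (fieldDeriv (𝒢.rightField Z) f) =
      fieldDeriv (𝒢.rightField Z) (fieldDeriv (𝒢.leftField X) f) := by
  funext g
  obtain ⟨h, hsm, h0, hv, ht⟩ := 𝒢.exists_curve_leftRep (𝒢.src g) (X (𝒢.src g))
  obtain ⟨k, ksm, k0, kv, ks⟩ := 𝒢.op.exists_curve_leftRep (𝒢.tgt g) (Z (𝒢.tgt g))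
  replace ks : ∀ r, 𝒢.src (k r) = 𝒢.tgt g := ks
  have hfd : MDifferentiable 𝓘(ℝ, EG) 𝓘(ℝ, ℝ) f := hf.mdifferentiable (by simp)
  have tm : ∀ s, 𝒢.tgt (𝒢.mul g (h s)) = 𝒢.tgt g := fun s => 𝒢.tgt_mul _ _ (ht s).symm
  have sm : ∀ r, 𝒢.src (𝒢.mul (k r) g) = 𝒢.src g := fun r => 𝒢.src_mul _ _ (ks r)
  -- Ψ(r,s) = f(k_r g h_s): the two fields act from opposite sides, so by associativity the two
  -- iterated derivatives are the mixed partials of Ψ at 0.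
  let Ψ : ℝ × ℝ → ℝ := fun p => f (𝒢.mul (𝒢.mul (k p.1) g) (h p.2))
  have assoc : ∀ r s, 𝒢.mul (k r) (𝒢.mul g (h s)) = 𝒢.mul (𝒢.mul (k r) g) (h s) := fun r s =>
    (𝒢.mul_assoc _ _ _ (ks r) (ht s).symm).symm
  have e1 : ∀ s, fieldDeriv (𝒢.rightField Z) f (𝒢.mul g (h s)) = deriv (fun r => Ψ (r, s)) 0 := by
    intro s
    have := (𝒢.op.hasDerivAt_fieldDeriv_leftField Z (tm s) k0 kv ks (hfd _)).deriv
    rw [rightField_eq_op, ← this]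
    exact congrArg (fun u : ℝ → ℝ => deriv u 0) (funext fun r => congrArg f (assoc r s))
  have e2 : ∀ r, fieldDeriv (𝒢.leftField X) f (𝒢.mul (k r) g) = deriv (fun s => Ψ (r, s)) 0 :=
    fun r => (𝒢.hasDerivAt_fieldDeriv_leftField X (sm r) h0 hv ht (hfd _)).deriv.symm
  have a1 := (𝒢.hasDerivAt_fieldDeriv_leftField X rfl h0 hv ht
    ((contMDiff_fieldDeriv_rightField hZ hf).mdifferentiable (by simp) g)).deriv
  have a2 := (𝒢.op.hasDerivAt_fieldDeriv_leftField Z rfl k0 kv ks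
    ((contMDiff_fieldDeriv_leftField hX hf).mdifferentiable (by simp) g)).deriv
  have a2' : deriv (fun r => fieldDeriv (𝒢.leftField X) f (𝒢.mul (k r) g)) 0 =
      fieldDeriv (𝒢.rightField Z) (fieldDeriv (𝒢.leftField X) f) g := a2
  simp only [e1] at a1
  simp only [e2] at a2'
  rw [← a1, ← a2']
  refine deriv_deriv_comm ?_
  have mulsm : ∀ {p q : ℝ × ℝ → G}, ContMDiffAt 𝓘(ℝ, ℝ × ℝ) 𝓘(ℝ, EG) ∞ p 0 →
      ContMDiffAt 𝓘(ℝ, ℝ × ℝ) 𝓘(ℝ, EG) ∞ q 0 → (∀ z, 𝒢.src (p z) = 𝒢.tgt (q z)) →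
      ContMDiffAt 𝓘(ℝ, ℝ × ℝ) 𝓘(ℝ, EG) ∞ (fun z => 𝒢.mul (p z) (q z)) 0 := by
    intro p q hp hq hpq
    have h1 := (𝒢.contMDiffOn_mul (p 0, q 0) (hpq 0)).comp (s := Set.univ) (0 : ℝ × ℝ)
      (hp.prodMk hq).contMDiffWithinAt fun z _ => hpq z
    exact contMDiffWithinAt_univ.1 h1
  have hk : ContMDiffAt 𝓘(ℝ, ℝ × ℝ) 𝓘(ℝ, EG) ∞ (fun z : ℝ × ℝ => k z.1) 0 :=
    ContMDiffAt.comp (I' := 𝓘(ℝ, ℝ)) (0 : ℝ × ℝ) ksm contDiff_fst.contMDiff.contMDiffAt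
  have hh : ContMDiffAt 𝓘(ℝ, ℝ × ℝ) 𝓘(ℝ, EG) ∞ (fun z : ℝ × ℝ => h z.2) 0 :=
    ContMDiffAt.comp (I' := 𝓘(ℝ, ℝ)) (0 : ℝ × ℝ) hsm contDiff_snd.contMDiff.contMDiffAt
  have hΨ : ContMDiffAt 𝓘(ℝ, ℝ × ℝ) 𝓘(ℝ, ℝ) ∞ Ψ 0 :=
    ContMDiffAt.comp (0 : ℝ × ℝ) hf.contMDiffAt
      (mulsm (mulsm hk contMDiffAt_const fun z => ks z.1) hh fun z => (sm z.1).trans (ht z.2).symm)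
  exact hΨ.contDiffAt.of_le (WithTop.coe_le_coe.2 le_top)

end LieGroupoid

/-! ### Inversion, third derivatives, and duality before passing to E/K^F -/

namespace LieGroupoid

variable {EM : Type*} [NormedAddCommGroup EM] [NormedSpace ℝ EM]
  {M : Type*} [TopologicalSpace M] [ChartedSpace EM M]
  {EG : Type*} [NormedAddCommGroup EG] [NormedSpace ℝ EG]
  {G : Type*} [TopologicalSpace G] [ChartedSpace EG G]

theorem rightRep_leftRep (𝒢 : LieGroupoid EM M EG G) (x : M) (e : 𝒢.Fibre x) :
    𝒢.rightRep x e = 𝒢.leftRep x e - 𝒢.dUnit x (𝒢.dSrc x (𝒢.leftRep x e)) := by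
  conv_lhs => rw [← 𝒢.mk_leftRep x e]
  rfl

theorem dUnit_anchor (𝒢 : LieGroupoid EM M EG G) (x : M) (e : 𝒢.Fibre x) :
    𝒢.dUnit x (𝒢.anchor x e) = 𝒢.leftRep x e - 𝒢.rightRep x e := by
  obtain ⟨v, rfl⟩ := Submodule.Quotient.mk_surjective _ e
  show 𝒢.dUnit x (𝒢.dSrc x v - 𝒢.dTgt x v) =
    (v - 𝒢.dUnit x (𝒢.dTgt x v)) - (v - 𝒢.dUnit x (𝒢.dSrc x v))
  rw [map_sub]
  abel

/-- The differential of the multiplication at a unit, in terms of curves. -/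
theorem exists_hasVelocity_mul (𝒢 : LieGroupoid EM M EG G) (x : M) :
    ∃ D : EG × EG →L[ℝ] EG, ∀ (p q : ℝ → G) (a b : EG), p 0 = 𝒢.unit x → q 0 = 𝒢.unit x →
      HasVelocity p a → HasVelocity q b → (∀ r, 𝒢.src (p r) = 𝒢.tgt (q r)) →
      HasVelocity (fun r => 𝒢.mul (p r) (q r)) (D (a, b)) := by
  obtain ⟨U, m, hU, h0, hm, hmul⟩ := 𝒢.exists_mul_extension (g₀ := 𝒢.unit x) (h₀ := 𝒢.unit x)
    ((𝒢.src_unit x).trans (𝒢.tgt_unit x).symm)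
  refine ⟨mfderiv (𝓘(ℝ, EG).prod 𝓘(ℝ, EG)) 𝓘(ℝ, EG) m (𝒢.unit x, 𝒢.unit x),
    fun p q a b hp hq ha hb hpq => ?_⟩
  have hmd : HasMFDerivAt (𝓘(ℝ, EG).prod 𝓘(ℝ, EG)) 𝓘(ℝ, EG) m (p 0, q 0)
      (mfderiv (𝓘(ℝ, EG).prod 𝓘(ℝ, EG)) 𝓘(ℝ, EG) m (𝒢.unit x, 𝒢.unit x) :
        EG × EG →L[ℝ] EG) := by
    rw [hp, hq]
    exact ((hm.contMDiffAt (hU.mem_nhds h0)).mdifferentiableAt (by simp)).hasMFDerivAt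
  have h2 := HasMFDerivAt.comp (0 : ℝ) hmd (ha.prodMk hb)
  have h3 : (fun r => 𝒢.mul (p r) (q r)) =ᶠ[𝓝 0] m ∘ fun r => (p r, q r) := by
    have hcc : ContinuousAt (fun r => (p r, q r)) 0 := ha.continuousAt.prodMk hb.continuousAt
    filter_upwards [hcc.eventually (hU.mem_nhds (by show (p 0, q 0) ∈ U; rwa [hp, hq]))] with r hr
    exact (hmul _ hr (hpq r)).symm
  refine HasVelocity.congr (c := m ∘ fun r => (p r, q r)) ?_ h3
  exact h2.congr_mfderiv (ContinuousLinearMap.ext fun (r : ℝ) =>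
    ContinuousLinearMap.map_smul _ r _)

/-- Let `w`, `u`, `v` be the velocities of c, c⁻¹ and of the units at the sources of c. The
differential `D` of the multiplication is linear and (w,u) = (w,v) + (v,u) - (v,v). The unit laws
and c·c⁻¹ = unit turn this into 0 = w + u - v. -/
theorem hasVelocity_inv (𝒢 : LieGroupoid EM M EG G) {x : M} {e : 𝒢.Fibre x} {c : ℝ → G}
    (hc0 : c 0 = 𝒢.unit x) (hc : HasVelocity (EG := EG) c (𝒢.leftRep x e))
    (ht : ∀ r, 𝒢.tgt (c r) = x) :
    HasVelocity (EG := EG) (fun r => 𝒢.inv (c r)) (-𝒢.rightRep x e) := by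
  obtain ⟨D, hD⟩ := 𝒢.exists_hasVelocity_mul x
  set w : EG := 𝒢.leftRep x e with hw
  set d : ℝ → G := fun r => 𝒢.inv (c r) with hd
  set j : ℝ → G := fun r => 𝒢.unit (𝒢.src (c r)) with hj
  have hd0 : d 0 = 𝒢.unit x := by rw [hd]; simp only [hc0, 𝒢.inv_unit]
  have hj0 : j 0 = 𝒢.unit x := by rw [hj]; simp only [hc0, 𝒢.src_unit]
  set u : EG := mfderiv 𝓘(ℝ, EG) 𝓘(ℝ, EG) 𝒢.inv (c 0) w with hu
  have hdu : HasVelocity d u :=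
    hc.comp (𝒢.contMDiff_inv.mdifferentiable (by simp) _).hasMFDerivAt
  set v : EG := 𝒢.dUnit x (𝒢.dSrc x w) with hv
  have hjv : HasVelocity j v := by
    have hs : HasMFDerivAt 𝓘(ℝ, EG) 𝓘(ℝ, EM) 𝒢.src (c 0) (𝒢.dSrc x : EG →L[ℝ] EM) := by
      rw [hc0]
      exact (𝒢.contMDiff_src.mdifferentiable (by simp) _).hasMFDerivAt
    have hι : HasMFDerivAt 𝓘(ℝ, EM) 𝓘(ℝ, EG) 𝒢.unit (𝒢.src (c 0))
        (𝒢.dUnit x : EM →L[ℝ] EG) := by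
      rw [hc0, 𝒢.src_unit]
      exact (𝒢.contMDiff_unit.mdifferentiable (by simp) _).hasMFDerivAt
    exact (hc.comp hs).comp hι
  have jt : ∀ r, 𝒢.tgt (j r) = 𝒢.src (c r) := fun r => 𝒢.tgt_unit _
  have js : ∀ r, 𝒢.src (j r) = 𝒢.src (c r) := fun r => 𝒢.src_unit _
  have dt : ∀ r, 𝒢.tgt (d r) = 𝒢.src (c r) := fun r => 𝒢.tgt_inv _
  have e1 : D (w, v) = w := (hD c j w v hc0 hj0 hc hjv fun r => (jt r).symm).unique
    (hc.congr (Filter.Eventually.of_forall fun r => 𝒢.mul_unit (c r)))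
  have e2 : D (v, u) = u := (hD j d v u hj0 hd0 hjv hdu fun r => (js r).trans (dt r).symm).unique
    (hdu.congr (Filter.Eventually.of_forall fun r => by
      have h := 𝒢.unit_mul (d r)
      rwa [dt] at h))
  have e3 : D (v, v) = v := (hD j j v v hj0 hj0 hjv hjv fun r => (js r).trans (jt r).symm).unique
    (hjv.congr (Filter.Eventually.of_forall fun r => by
      have h := 𝒢.unit_mul (j r)
      rwa [jt] at h))
  have e4 : D (w, u) = 0 := (hD c d w u hc0 hd0 hc hdu fun r => (dt r).symm).unique
    ((HasVelocity.const (𝒢.unit x)).congr (Filter.Eventually.of_forall fun r => by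
      show 𝒢.mul (c r) (𝒢.inv (c r)) = _
      rw [𝒢.mul_inv, ht]))
  have e5 : w + (u - v) = 0 := by
    have h : D (w, u) = D (w, v) + D (v, u) - D (v, v) := by
      rw [← map_add, ← map_sub]
      simp
    rw [e1, e2, e3, e4] at h
    rw [h]
    abel
  refine hdu.of_eq ?_
  have e6 : (𝒢.rightRep x e : EG) = w - v := 𝒢.rightRep_leftRep x e
  have e7 : u = v - w := by
    have := eq_neg_of_add_eq_zero_right e5
    rw [sub_eq_iff_eq_add] at this
    rw [this]; abel
  rw [e7]
  refine Eq.trans ?_ (congrArg (fun z : EG => -z) e6.symm)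
  exact (neg_sub w v).symm

variable {𝒢 : LieGroupoid EM M EG G} {X Y Z : ∀ x, 𝒢.Fibre x} {f : G → ℝ}
variable [IsManifold 𝓘(ℝ, EG) ∞ G]

/-- The inversion maps the left-invariant to minus the right-invariant vector fields. -/
theorem fieldDeriv_leftField_comp_inv (X : ∀ x, 𝒢.Fibre x)
    (hf : MDifferentiable 𝓘(ℝ, EG) 𝓘(ℝ, ℝ) f) :
    fieldDeriv (𝒢.leftField X) (fun g => f (𝒢.inv g)) =
      fun g => -1 * fieldDeriv (𝒢.rightField X) f (𝒢.inv g) := by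
  funext g
  obtain ⟨c, -, h0, hv, ht⟩ := 𝒢.exists_curve_leftRep (𝒢.src g) (X (𝒢.src g))
  have hfi : MDifferentiable 𝓘(ℝ, EG) 𝓘(ℝ, ℝ) fun g => f (𝒢.inv g) :=
    hf.comp (𝒢.contMDiff_inv.mdifferentiable (by simp))
  have a1 := 𝒢.hasDerivAt_fieldDeriv_leftField X rfl h0 hv ht (hfi g)
  have i0 : 𝒢.inv (c 0) = 𝒢.unit (𝒢.src g) := by rw [h0, 𝒢.inv_unit]
  have iv : HasVelocity (EG := EG) (fun r => 𝒢.inv (c r))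
      (𝒢.rightRep (𝒢.src g) ((-X) (𝒢.src g))) := by
    refine (𝒢.hasVelocity_inv h0 hv ht).of_eq ?_
    exact (map_neg (𝒢.rightRep (𝒢.src g)) _).symm
  have a2 := 𝒢.op.hasDerivAt_fieldDeriv_leftField (-X) (g := 𝒢.inv g) (𝒢.tgt_inv g) i0 iv
    (fun r => (𝒢.src_inv _).trans (ht r)) (hf _)
  -- Inversion reverses products, so left translation of `c` becomes right translation of its
  -- inverse, whose velocity represents `-X`.
  have e : (fun r => f (𝒢.inv (𝒢.mul g (c r)))) =
      fun r => f (𝒢.mul (𝒢.inv (c r)) (𝒢.inv g)) :=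
    funext fun r => congrArg f (𝒢.inv_mul_eq (ht r).symm)
  simp only [e] at a1
  refine (a1.unique a2).trans ?_
  have hneg : 𝒢.op.leftField (-X) = fun g => (-1 : ℝ) • 𝒢.rightField X g :=
    funext fun g => (𝒢.op.leftField_neg X g).trans (neg_one_smul ℝ _).symm
  rw [hneg]
  exact fieldDeriv_smul_field _ _ _ _

theorem fieldDeriv_rightField_comp_inv (X : ∀ x, 𝒢.Fibre x)
    (hf : MDifferentiable 𝓘(ℝ, EG) 𝓘(ℝ, ℝ) f) :
    fieldDeriv (𝒢.rightField X) (fun g => f (𝒢.inv g)) =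
      fun g => -1 * fieldDeriv (𝒢.leftField X) f (𝒢.inv g) :=
  fieldDeriv_leftField_comp_inv (𝒢 := 𝒢.op) X hf

/-- The value `X^L Y^L Z^R f |_M` at `x` depends on `Z` only through `Z x`. -/
theorem thirdDeriv_eq_zero_of_apply_eq_zero (X Y : ∀ x, 𝒢.Fibre x) {x : M} (hZ : Z x = 0) :
    𝒢.thirdDeriv f X Y Z x = 0 := by
  refine 𝒢.fieldDeriv_leftField_eq_zero X (x := x) (fun g hg => ?_) (𝒢.tgt_unit x)
  refine 𝒢.fieldDeriv_leftField_eq_zero Y (fun g hg => ?_) hg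
  have h : 𝒢.rightField Z g = 0 := 𝒢.op.leftField_eq_zero Z (by
    subst hg; exact hZ)
  rw [fieldDeriv, h]
  exact map_zero _

variable [IsManifold 𝓘(ℝ, EM) ∞ M]

/-- Each of the three fields changes sides and contributes a factor -1, and inversion fixes the
units. -/
theorem thirdDeriv_comp_inv (hf : ContMDiff 𝓘(ℝ, EG) 𝓘(ℝ, ℝ) ∞ f)
    (hY : 𝒢.IsSmoothSection Y) (hZ : 𝒢.IsSmoothSection Z) (X : ∀ x, 𝒢.Fibre x) (x : M) :
    𝒢.thirdDeriv (fun g => f (𝒢.inv g)) X Y Z x =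
      -fieldDeriv (𝒢.rightField X) (fieldDeriv (𝒢.rightField Y)
        (fieldDeriv (𝒢.leftField Z) f)) (𝒢.unit x) := by
  have s1 := contMDiff_fieldDeriv_leftField hZ hf
  have s2 := contMDiff_fieldDeriv_rightField hY s1
  rw [thirdDeriv, fieldDeriv_rightField_comp_inv Z (hf.mdifferentiable (by simp))]
  have e1 : fieldDeriv (𝒢.leftField Y) (fun g => -1 * fieldDeriv (𝒢.leftField Z) f (𝒢.inv g)) =
      fun g => fieldDeriv (𝒢.rightField Y) (fieldDeriv (𝒢.leftField Z) f) (𝒢.inv g) := by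
    funext g
    have h : MDifferentiableAt 𝓘(ℝ, EG) 𝓘(ℝ, ℝ)
        (fun g => fieldDeriv (𝒢.leftField Z) f (𝒢.inv g)) g :=
      (s1.comp 𝒢.contMDiff_inv).mdifferentiable (by simp) g
    rw [fieldDeriv_const_mul _ _ h,
      fieldDeriv_leftField_comp_inv Y (s1.mdifferentiable (by simp))]
    ring
  rw [e1, fieldDeriv_leftField_comp_inv X (s2.mdifferentiable (by simp))]
  simp only [𝒢.inv_unit]
  ring

theorem contMDiff_thirdDeriv (hf : ContMDiff 𝓘(ℝ, EG) 𝓘(ℝ, ℝ) ∞ f) (hX : 𝒢.IsSmoothSection X)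
    (hY : 𝒢.IsSmoothSection Y) (hZ : 𝒢.IsSmoothSection Z) :
    ContMDiff 𝓘(ℝ, EM) 𝓘(ℝ, ℝ) ∞ (𝒢.thirdDeriv f X Y Z) :=
  (contMDiff_fieldDeriv_leftField hX (contMDiff_fieldDeriv_leftField hY
    (contMDiff_fieldDeriv_rightField hZ hf))).comp 𝒢.contMDiff_unit

theorem thirdDeriv_add_right (hf : ContMDiff 𝓘(ℝ, EG) 𝓘(ℝ, ℝ) ∞ f) (X : ∀ x, 𝒢.Fibre x)
    (hY : 𝒢.IsSmoothSection Y) {Z Z' : ∀ x, 𝒢.Fibre x} (hZ : 𝒢.IsSmoothSection Z)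
    (hZ' : 𝒢.IsSmoothSection Z') (x : M) :
    𝒢.thirdDeriv f X Y (Z + Z') x = 𝒢.thirdDeriv f X Y Z x + 𝒢.thirdDeriv f X Y Z' x := by
  have h0 : 𝒢.rightField (Z + Z') = fun g => 𝒢.rightField Z g + 𝒢.rightField Z' g :=
    funext fun g => 𝒢.op.leftField_add Z Z' g
  have s := contMDiff_fieldDeriv_rightField hZ hf
  have s' := contMDiff_fieldDeriv_rightField hZ' hf
  have h1 : fieldDeriv (𝒢.rightField (Z + Z')) f = fun g =>
      fieldDeriv (𝒢.rightField Z) f g + fieldDeriv (𝒢.rightField Z') f g := by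
    rw [h0]; exact funext fun g => fieldDeriv_add_field _ _ _ _
  have h2 : fieldDeriv (𝒢.leftField Y) (fieldDeriv (𝒢.rightField (Z + Z')) f) = fun g =>
      fieldDeriv (𝒢.leftField Y) (fieldDeriv (𝒢.rightField Z) f) g +
        fieldDeriv (𝒢.leftField Y) (fieldDeriv (𝒢.rightField Z') f) g := by
    rw [h1]
    exact funext fun g => fieldDeriv_add _ (s.mdifferentiable (by simp) g)
      (s'.mdifferentiable (by simp) g)
  rw [thirdDeriv, h2]
  exact fieldDeriv_add _
    ((contMDiff_fieldDeriv_leftField hY s).mdifferentiable (by simp) _)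
    ((contMDiff_fieldDeriv_leftField hY s').mdifferentiable (by simp) _)

theorem thirdDeriv_smul_right (hf : ContMDiff 𝓘(ℝ, EG) 𝓘(ℝ, ℝ) ∞ f) (X : ∀ x, 𝒢.Fibre x)
    (hY : 𝒢.IsSmoothSection Y) (a : ℝ) (hZ : 𝒢.IsSmoothSection Z) (x : M) :
    𝒢.thirdDeriv f X Y (a • Z) x = a * 𝒢.thirdDeriv f X Y Z x := by
  have h0 : 𝒢.rightField (a • Z) = fun g => a • 𝒢.rightField Z g :=
    funext fun g => 𝒢.op.leftField_smul a Z g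
  have s := contMDiff_fieldDeriv_rightField hZ hf
  have h1 : fieldDeriv (𝒢.rightField (a • Z)) f = fun g => a * fieldDeriv (𝒢.rightField Z) f g := by
    rw [h0]; exact funext fun g => fieldDeriv_smul_field _ _ _ _
  have h2 : fieldDeriv (𝒢.leftField Y) (fieldDeriv (𝒢.rightField (a • Z)) f) = fun g =>
      a * fieldDeriv (𝒢.leftField Y) (fieldDeriv (𝒢.rightField Z) f) g := by
    rw [h1]
    exact funext fun g => fieldDeriv_const_mul _ _ (s.mdifferentiable (by simp) g)
  rw [thirdDeriv, h2]
  exact fieldDeriv_const_mul _ _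
    ((contMDiff_fieldDeriv_leftField hY s).mdifferentiable (by simp) _)

theorem thirdDeriv_add_middle (hf : ContMDiff 𝓘(ℝ, EG) 𝓘(ℝ, ℝ) ∞ f) (X : ∀ x, 𝒢.Fibre x)
    {Y Y' : ∀ x, 𝒢.Fibre x} (hY : 𝒢.IsSmoothSection Y) (hY' : 𝒢.IsSmoothSection Y')
    (hZ : 𝒢.IsSmoothSection Z) (x : M) :
    𝒢.thirdDeriv f X (Y + Y') Z x = 𝒢.thirdDeriv f X Y Z x + 𝒢.thirdDeriv f X Y' Z x := by
  have h0 : 𝒢.leftField (Y + Y') = fun g => 𝒢.leftField Y g + 𝒢.leftField Y' g :=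
    funext fun g => 𝒢.leftField_add Y Y' g
  have s := contMDiff_fieldDeriv_rightField hZ hf
  have h2 : fieldDeriv (𝒢.leftField (Y + Y')) (fieldDeriv (𝒢.rightField Z) f) = fun g =>
      fieldDeriv (𝒢.leftField Y) (fieldDeriv (𝒢.rightField Z) f) g +
        fieldDeriv (𝒢.leftField Y') (fieldDeriv (𝒢.rightField Z) f) g := by
    rw [h0]
    exact funext fun g => fieldDeriv_add_field _ _ _ _
  rw [thirdDeriv, h2]
  exact fieldDeriv_add _
    ((contMDiff_fieldDeriv_leftField hY s).mdifferentiable (by simp) _)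
    ((contMDiff_fieldDeriv_leftField hY' s).mdifferentiable (by simp) _)

namespace ContrastFunction

variable (F : 𝒢.ContrastFunction)

/-- With the mixed representatives Y^L and Z^R, the metric is the restriction to M of exactly the
function that X^L differentiates in `thirdDeriv`. -/
theorem metric_eq_fieldDeriv (hZ : 𝒢.IsSmoothSection Z) (x : M) :
    F.metric x (Y x) (Z x) =
      fieldDeriv (𝒢.leftField Y) (fieldDeriv (𝒢.rightField Z) F.toFun) (𝒢.unit x) := by
  refine F.metric_eq x Y Z _ _ ((contMDiff_rightField hZ).mdifferentiable (by simp) _) ?_ ?_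
  · exact (congrArg Submodule.Quotient.mk (𝒢.leftField_unit Y x)).trans (𝒢.mk_leftRep x (Y x))
  · exact (congrArg Submodule.Quotient.mk (𝒢.rightField_unit Z x)).trans (𝒢.mk_rightRep x (Z x))

theorem contMDiff_metric (hY : 𝒢.IsSmoothSection Y) (hZ : 𝒢.IsSmoothSection Z) :
    ContMDiff 𝓘(ℝ, EM) 𝓘(ℝ, ℝ) ∞ fun x => F.metric x (Y x) (Z x) := by
  simp only [F.metric_eq_fieldDeriv hZ]
  exact (contMDiff_fieldDeriv_leftField hY
    (contMDiff_fieldDeriv_rightField hZ F.contMDiff)).comp 𝒢.contMDiff_unit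

/-- Duality on the level of third derivatives. -/
theorem thirdDeriv_add_thirdDeriv_star (X : ∀ x, 𝒢.Fibre x) (hY : 𝒢.IsSmoothSection Y)
    (hZ : 𝒢.IsSmoothSection Z) (x : M) :
    𝒢.thirdDeriv F.toFun X Y Z x + 𝒢.thirdDeriv F.star.toFun X Z Y x =
      𝒢.anchorDeriv X (fun y => F.metric y (Y y) (Z y)) x := by
  have h1 : 𝒢.thirdDeriv F.star.toFun X Z Y x = _ := thirdDeriv_comp_inv F.contMDiff hZ hY X x
  -- After commuting, both terms differentiate the same function Y^L Z^R F, along X^L and along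
  -- -X^R.
  rw [h1, ← fieldDeriv_leftField_rightField_comm hY hZ F.contMDiff, thirdDeriv]
  simp only [F.metric_eq_fieldDeriv hZ]
  set u := fieldDeriv (𝒢.leftField Y) (fieldDeriv (𝒢.rightField Z) F.toFun)
  have hu : ContMDiff 𝓘(ℝ, EG) 𝓘(ℝ, ℝ) ∞ u := contMDiff_fieldDeriv_leftField hY
    (contMDiff_fieldDeriv_rightField hZ F.contMDiff)
  have h2 := mfderiv_comp x (hu.mdifferentiable (by simp) (𝒢.unit x))
    (𝒢.contMDiff_unit.mdifferentiable (by simp) x)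
  let du : EG →L[ℝ] ℝ := mfderiv 𝓘(ℝ, EG) 𝓘(ℝ, ℝ) u (𝒢.unit x)
  have h3 : 𝒢.anchorDeriv X (fun y => u (𝒢.unit y)) x =
      du (𝒢.dUnit x (𝒢.anchor x (X x))) := DFunLike.congr_fun h2 _
  have h4 : fieldDeriv (𝒢.leftField X) u (𝒢.unit x) = du (𝒢.leftRep x (X x)) :=
    congrArg du (𝒢.leftField_unit X x)
  have h5 : fieldDeriv (𝒢.rightField X) u (𝒢.unit x) = du (𝒢.rightRep x (X x)) :=
    congrArg du (𝒢.rightField_unit X x)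
  rw [h3, h4, h5, dUnit_anchor, ← sub_eq_add_neg]
  exact (map_sub du _ _).symm

end ContrastFunction
end LieGroupoid

/-! ### Gram matrices and degenerate symmetric forms -/

section LinearAlgebra

variable {E : Type*} [AddCommGroup E] [Module ℝ E] {ι : Type*} [Fintype ι] [DecidableEq ι]
  {B : E →ₗ[ℝ] E →ₗ[ℝ] ℝ} {z : ι → E} {N : Matrix ι ι ℝ}

/-- The element of the span of the `z i` with prescribed products with the `z k`, where `N` is the
inverse of the Gram matrix. -/
theorem apply_sum_gram_inverse (hN : N * Matrix.of (fun i j => B (z i) (z j)) = 1) (w : ι → ℝ)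
    (k : ι) : B (∑ i, (∑ j, w j * N j i) • z i) (z k) = w k := by
  have h : ∀ j, ∑ i, N j i * B (z i) (z k) = if j = k then 1 else 0 := fun j => by
    have := congrFun (congrFun hN j) k
    rwa [Matrix.mul_apply, Matrix.one_apply] at this
  simp only [map_sum, map_smul, LinearMap.sum_apply, LinearMap.smul_apply, smul_eq_mul,
    Finset.sum_mul]
  rw [Finset.sum_comm]
  simp only [mul_assoc, ← Finset.mul_sum, h]
  simp

/-- Here `p` is the `B`-orthogonal projection of `e` to the span of the `z i`. The difference `e -
p` lies in the kernel of `B`, where both `τ` and `B d` vanish; on `p` they agree because they agree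
on every `z k`. -/
theorem apply_sum_gram_inverse_eq (hN : N * Matrix.of (fun i j => B (z i) (z j)) = 1)
    (hB : ∀ e e', B e e' = B e' e) (hker : ∀ e, (∀ k, B e (z k) = 0) → B e = 0)
    (τ : E →ₗ[ℝ] ℝ) (hτ : ∀ e, B e = 0 → τ e = 0) (e : E) :
    B (∑ i, (∑ j, τ (z j) * N j i) • z i) e = τ e := by
  set d := ∑ i, (∑ j, τ (z j) * N j i) • z i
  set p := ∑ i, (∑ j, B e (z j) * N j i) • z i with hp
  have hd : ∀ k, B d (z k) = τ (z k) := apply_sum_gram_inverse hN fun j => τ (z j)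
  have hk : B (e - p) = 0 := hker _ fun k => by
    rw [map_sub, LinearMap.sub_apply, hp, apply_sum_gram_inverse hN fun j => B e (z j), sub_self]
  have h1 : B d p = τ p := by
    rw [hp]
    simp only [map_sum, map_smul, hd]
  have h2 : τ e = τ p := by
    rw [← sub_eq_zero, ← map_sub, hτ _ hk]
  have h3 : B d e = B d p := by
    rw [← sub_eq_zero, ← map_sub, hB, hk, LinearMap.zero_apply]
  rw [h3, h1, h2]

/-- If the Gram matrix of a family of the complementary cardinality is invertible, then the
orthogonal of the family is the kernel of the form. -/
theorem eq_zero_of_forall_apply_eq_zero [FiniteDimensional ℝ E]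
    (hN : N * Matrix.of (fun i j => B (z i) (z j)) = 1)
    (hdim : Module.finrank ℝ (LinearMap.ker B) + Fintype.card ι = Module.finrank ℝ E) (e : E)
    (he : ∀ k, B e (z k) = 0) : B e = 0 := by
  let ℓ : E →ₗ[ℝ] (ι → ℝ) := LinearMap.pi fun k => B.flip (z k)
  have hsurj : LinearMap.range ℓ = ⊤ := LinearMap.range_eq_top.2 fun w =>
    ⟨∑ i, (∑ j, w j * N j i) • z i, funext fun k => apply_sum_gram_inverse hN w k⟩
  have h1 := ℓ.finrank_range_add_finrank_ker
  rw [hsurj, finrank_top, Module.finrank_fintype_fun_eq_card] at h1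
  have h2 : LinearMap.ker B ≤ LinearMap.ker ℓ := fun e he => by
    rw [LinearMap.mem_ker] at he ⊢
    funext k
    show B e (z k) = 0
    rw [he, LinearMap.zero_apply]
  -- Surjectivity of `ℓ` gives its kernel the dimension of the kernel of `B`, which it contains.
  have h3 : LinearMap.ker B = LinearMap.ker ℓ := Submodule.eq_of_le_of_finrank_eq h2 (by omega)
  have h4 : e ∈ LinearMap.ker ℓ := LinearMap.mem_ker.2 (funext he)
  rw [← h3] at h4
  exact h4

end LinearAlgebra

/-! ### Smooth determinants, adjugates and cutoffs -/

section Cutoff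

variable {EM : Type*} [NormedAddCommGroup EM] [NormedSpace ℝ EM]
  {M : Type*} [TopologicalSpace M] [ChartedSpace EM M]

theorem ContMDiff.matrix_det {ι : Type*} [Fintype ι] [DecidableEq ι] {A : M → Matrix ι ι ℝ}
    (hA : ∀ i j, ContMDiff 𝓘(ℝ, EM) 𝓘(ℝ, ℝ) ∞ fun x => A x i j) :
    ContMDiff 𝓘(ℝ, EM) 𝓘(ℝ, ℝ) ∞ fun x => (A x).det := by
  simp only [Matrix.det_apply']
  exact contMDiff_finsetSum fun σ _ => contMDiff_const.mul
    (contMDiff_finsetProd fun i _ => hA _ _)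

theorem ContMDiff.matrix_adjugate {ι : Type*} [Fintype ι] [DecidableEq ι] {A : M → Matrix ι ι ℝ}
    (hA : ∀ i j, ContMDiff 𝓘(ℝ, EM) 𝓘(ℝ, ℝ) ∞ fun x => A x i j) (i j : ι) :
    ContMDiff 𝓘(ℝ, EM) 𝓘(ℝ, ℝ) ∞ fun x => (A x).adjugate i j := by
  simp only [Matrix.adjugate_apply]
  refine ContMDiff.matrix_det fun k l => ?_
  by_cases h : k = j
  · subst h
    simp only [Matrix.updateRow_self]
    exact contMDiff_const
  · simp only [Matrix.updateRow_ne h]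
    exact hA k l

variable [FiniteDimensional ℝ EM] [IsManifold 𝓘(ℝ, EM) ∞ M] [T2Space M]

theorem exists_contMDiff_cutoff {x₀ : M} {V : Set M} (hV : V ∈ 𝓝 x₀) :
    ∃ ψ : M → ℝ, ContMDiff 𝓘(ℝ, EM) 𝓘(ℝ, ℝ) ∞ ψ ∧ (∀ᶠ x in 𝓝 x₀, ψ x = 1) ∧
      tsupport ψ ⊆ V := by
  obtain ⟨ψ, -, hψ⟩ := (SmoothBumpFunction.nhds_basis_tsupport (I := 𝓘(ℝ, EM)) x₀).mem_iff.1 hV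
  exact ⟨ψ, ψ.contMDiff, ψ.eventuallyEq_one, hψ⟩

/-- The reciprocal of `δ` is multiplied by a cutoff supported where `δ` does not vanish, so it is
smooth on all of M. -/
theorem exists_contMDiff_mul_eq_one {x₀ : M} {δ : M → ℝ}
    (hδ : ContMDiff 𝓘(ℝ, EM) 𝓘(ℝ, ℝ) ∞ δ) (h0 : δ x₀ ≠ 0) :
    ∃ ρ : M → ℝ, ContMDiff 𝓘(ℝ, EM) 𝓘(ℝ, ℝ) ∞ ρ ∧ ∀ᶠ x in 𝓝 x₀, ρ x * δ x = 1 := by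
  have hV : {x | δ x ≠ 0} ∈ 𝓝 x₀ := hδ.continuous.continuousAt.eventually_ne h0
  obtain ⟨ψ, hψ, h1, hs⟩ := exists_contMDiff_cutoff (EM := EM) hV
  refine ⟨fun x => ψ x * (δ x)⁻¹, contMDiff_of_tsupport fun x hx => ?_, ?_⟩
  · have hx' : δ x ≠ 0 := hs (tsupport_mul_subset_left hx)
    exact (hψ x).mul ((hδ x).inv₀ hx')
  · filter_upwards [h1, hV] with x hx hx'
    rw [hx, one_mul, inv_mul_cancel₀ hx']

end Cutoff

/-! ### Frames complementary to K^F, and extension of elements of K^F -/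

namespace LieGroupoid

variable {EM : Type*} [NormedAddCommGroup EM] [NormedSpace ℝ EM]
  {M : Type*} [TopologicalSpace M] [ChartedSpace EM M]
  {EG : Type*} [NormedAddCommGroup EG] [NormedSpace ℝ EG]
  {G : Type*} [TopologicalSpace G] [ChartedSpace EG G]
  {𝒢 : LieGroupoid EM M EG G}

instance [FiniteDimensional ℝ EG] (x : M) : FiniteDimensional ℝ (𝒢.Fibre x) :=
  haveI : FiniteDimensional ℝ (TangentSpace 𝓘(ℝ, EG) (𝒢.unit x)) := ‹FiniteDimensional ℝ EG›
  inferInstance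

/-- The differential of the unit map is injective, being split by `dSrc`. Hence all fibres of E have
the same dimension, and constant rank of K^F means constant corank. -/
theorem finrank_fibre_add [FiniteDimensional ℝ EG] (𝒢 : LieGroupoid EM M EG G) (x : M) :
    Module.finrank ℝ (𝒢.Fibre x) + Module.finrank ℝ EM = Module.finrank ℝ EG := by
  have : FiniteDimensional ℝ (TangentSpace 𝓘(ℝ, EG) (𝒢.unit x)) := ‹FiniteDimensional ℝ EG›
  have h1 := Submodule.finrank_quotient_add_finrank (LinearMap.range (𝒢.dUnit x).toLinearMap)
  have h2 := LinearMap.finrank_range_of_inj (f := (𝒢.dUnit x).toLinearMap)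
    (Function.LeftInverse.injective (g := 𝒢.dSrc x) fun v => 𝒢.dSrc_dUnit x v)
  rw [h2] at h1
  exact h1

theorem anchorDeriv_eq_zero {X : ∀ x, 𝒢.Fibre x} {u : M → ℝ} {x : M} (hu : ∀ᶠ y in 𝓝 x, u y = 0) :
    𝒢.anchorDeriv X u x = 0 := by
  have h : u =ᶠ[𝓝 x] fun _ => 0 := hu
  rw [anchorDeriv, h.mfderiv_eq, mfderiv_const]
  rfl

variable [IsManifold 𝓘(ℝ, EG) ∞ G]

namespace ContrastFunction

variable {F : 𝒢.ContrastFunction} {f : G → ℝ} {X Y : ∀ x, 𝒢.Fibre x}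

theorem eq_zero_of_transMetric_eq_zero {x : M} {d : F.TransFibre x}
    (h : ∀ d', F.transMetric x d d' = 0) : d = 0 := by
  obtain ⟨e, rfl⟩ := Submodule.Quotient.mk_surjective _ d
  refine (Submodule.Quotient.mk_eq_zero _).2 (LinearMap.mem_ker.2 (LinearMap.ext fun e' => ?_))
  exact (F.transMetric_mk x e e').symm.trans (h _)

theorem transMetric_symm (x : M) (d d' : F.TransFibre x) :
    F.transMetric x d d' = F.transMetric x d' d := by
  obtain ⟨e, rfl⟩ := Submodule.Quotient.mk_surjective _ d
  obtain ⟨e', rfl⟩ := Submodule.Quotient.mk_surjective _ d'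
  rw [F.transMetric_mk, F.transMetric_mk, F.metric_symm]

variable [FiniteDimensional ℝ EM] [IsManifold 𝓘(ℝ, EM) ∞ M] [T2Space M] [FiniteDimensional ℝ EG]

/-- Near every point there are smooth sections of `E` that form a frame of a complement of `K^F`;
they come with the inverse of their Gram matrix. -/
theorem IsRegular.exists_frame (hF : F.IsRegular) (x₀ : M) :
    ∃ (r : ℕ) (Z : Fin r → ∀ x, 𝒢.Fibre x) (N : M → Matrix (Fin r) (Fin r) ℝ),
      (∀ i, 𝒢.IsSmoothSection (Z i)) ∧
      (∀ i j, ContMDiff 𝓘(ℝ, EM) 𝓘(ℝ, ℝ) ∞ fun x => N x i j) ∧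
      ∀ᶠ x in 𝓝 x₀, N x * Matrix.of (fun i j => F.metric x (Z i x) (Z j x)) = 1 ∧
        ∀ e, (∀ k, F.metric x e (Z k x) = 0) → F.metric x e = 0 := by
  let b := Module.finBasis ℝ (F.TransFibre x₀)
  choose e he using fun i => Submodule.Quotient.mk_surjective (F.kernel x₀) (b i)
  choose Z hZ hZe using fun i => 𝒢.exists_isSmoothSection_apply_eq x₀ (e i)
  let H : M → Matrix _ _ ℝ := fun x => Matrix.of (fun i j => F.metric x (Z i x) (Z j x))
  have hH : ∀ i j, ContMDiff 𝓘(ℝ, EM) 𝓘(ℝ, ℝ) ∞ fun x => H x i j := fun i j =>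
    F.contMDiff_metric (hZ i) (hZ j)
  -- At `x₀` this is the Gram matrix of the nondegenerate transversal metric in a basis: a null
  -- vector would give a combination of the basis orthogonal to everything.
  have hdet : (H x₀).det ≠ 0 := by
    intro h
    obtain ⟨v, hv, hv0⟩ := Matrix.exists_mulVec_eq_zero_iff.2 h
    refine hv ?_
    have hH0 : ∀ i j, H x₀ i j = F.transMetric x₀ (b i) (b j) := fun i j => by
      rw [← he i, ← he j, F.transMetric_mk]
      show F.metric x₀ (Z i x₀) (Z j x₀) = _
      rw [hZe, hZe]
    have h1 : ∑ j, v j • b j = 0 := by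
      have h2 : ∀ i, F.transMetric x₀ (b i) (∑ j, v j • b j) = 0 := fun i => by
        have := congrFun hv0 i
        simp only [Matrix.mulVec, dotProduct, hH0] at this
        simp only [map_sum, map_smul, smul_eq_mul]
        rw [← Pi.zero_apply (M := fun _ => ℝ) i, ← this]
        exact Finset.sum_congr rfl fun j _ => mul_comm _ _
      have h3 : (F.transMetric x₀).flip (∑ j, v j • b j) = 0 := b.ext fun i => h2 i
      refine eq_zero_of_transMetric_eq_zero fun d' => ?_
      have h4 : F.transMetric x₀ d' (∑ j, v j • b j) = 0 := DFunLike.congr_fun h3 d'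
      rw [← h4, transMetric_symm]
    have h5 := Fintype.linearIndependent_iff.1 b.linearIndependent v h1
    exact funext h5
  obtain ⟨ρ, hρ, hρ1⟩ := exists_contMDiff_mul_eq_one (ContMDiff.matrix_det hH) hdet
  refine ⟨_, Z, fun x => ρ x • (H x).adjugate, hZ, fun i j =>
    hρ.mul (ContMDiff.matrix_adjugate hH i j), ?_⟩
  filter_upwards [hρ1] with x hx
  have hN : (ρ x • (H x).adjugate) * H x = 1 := by
    rw [Matrix.smul_mul, Matrix.adjugate_mul, smul_smul, hx, one_smul]
  refine ⟨hN, fun e he => eq_zero_of_forall_apply_eq_zero hN ?_ e he⟩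
  -- The frame has as many members as the corank of K^F at `x₀`, which is also the corank at `x`.
  have h1 : Module.finrank ℝ (F.TransFibre x₀) + Module.finrank ℝ (F.kernel x₀) =
      Module.finrank ℝ (𝒢.Fibre x₀) := Submodule.finrank_quotient_add_finrank (F.kernel x₀)
  have h2 := 𝒢.finrank_fibre_add x₀
  have h3 := 𝒢.finrank_fibre_add x
  have h4 := hF x x₀
  rw [Fintype.card_fin]
  show Module.finrank ℝ (F.kernel x) + _ = _
  omega

/-- Every element of `K^F` extends to a global smooth section of `K^F`. -/
theorem IsRegular.exists_section_kernel (hF : F.IsRegular) {x₀ : M} {e : 𝒢.Fibre x₀}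
    (he : e ∈ F.kernel x₀) :
    ∃ W, 𝒢.IsSmoothSection W ∧ (∀ x, W x ∈ F.kernel x) ∧ W x₀ = e := by
  obtain ⟨r, Z, N, hZ, hN, hev⟩ := hF.exists_frame x₀
  obtain ⟨W, hW, rfl⟩ := 𝒢.exists_isSmoothSection_apply_eq x₀ e
  obtain ⟨ψ, hψ, hψ1, hψs⟩ := exists_contMDiff_cutoff (EM := EM) hev
  -- Subtracting the orthogonal projection to the frame moves `W` into K^F near `x₀`; at `x₀`
  -- nothing is subtracted, since `W x₀` is already in the kernel.
  let P : ∀ x, 𝒢.Fibre x := fun x => ∑ i, (∑ j, F.metric x (W x) (Z j x) * N x j i) • Z i x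
  have hP : 𝒢.IsSmoothSection P := IsSmoothSection.sum _ (fun i =>
    contMDiff_finsetSum fun j _ => (F.contMDiff_metric hW (hZ j)).mul (hN j i)) hZ
  refine ⟨fun x => ψ x • (W - P) x, (hW.sub hP).smul hψ, fun x => ?_, ?_⟩
  · by_cases hx : x ∈ tsupport ψ
    · obtain ⟨h1, h2⟩ := hψs hx
      refine Submodule.smul_mem _ _ (LinearMap.mem_ker.2 (h2 _ fun k => ?_))
      rw [Pi.sub_apply, map_sub, LinearMap.sub_apply,
        apply_sum_gram_inverse h1 fun j => F.metric x (W x) (Z j x), sub_self]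
    · show ψ x • (W - P) x ∈ F.kernel x
      rw [image_eq_zero_of_notMem_tsupport hx, zero_smul]
      exact Submodule.zero_mem _
  · have h1 : F.metric x₀ (W x₀) = 0 := he
    have h2 : P x₀ = 0 := by
      simp only [P, h1, LinearMap.zero_apply, zero_mul, Finset.sum_const_zero, zero_smul]
    show ψ x₀ • (W - P) x₀ = W x₀
    rw [hψ1.self_of_nhds, one_smul, Pi.sub_apply, h2, sub_zero]

/-- If `X^L Y^L Z^R f |_M` vanishes for all sections `Z` of `K^F`, then it vanishes at every point
at which the value of `Z` lies in `K^F`. -/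
theorem IsRegular.thirdDeriv_eq_zero_of_mem_kernel (hF : F.IsRegular)
    (hf : ContMDiff 𝓘(ℝ, EG) 𝓘(ℝ, ℝ) ∞ f) (hY : 𝒢.IsSmoothSection Y)
    (h0 : ∀ Z, 𝒢.IsSmoothSection Z → (∀ x, Z x ∈ F.kernel x) → ∀ x, 𝒢.thirdDeriv f X Y Z x = 0)
    {Z : ∀ x, 𝒢.Fibre x} (hZ : 𝒢.IsSmoothSection Z) {x : M} (hx : Z x ∈ F.kernel x) :
    𝒢.thirdDeriv f X Y Z x = 0 := by
  obtain ⟨W, hW, hWK, hWx⟩ := hF.exists_section_kernel hx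
  have h1 := thirdDeriv_add_right hf X hY hW (hZ.sub hW) x
  rw [add_sub_cancel, h0 W hW hWK x, zero_add] at h1
  rw [h1]
  exact thirdDeriv_eq_zero_of_apply_eq_zero X Y (by rw [Pi.sub_apply, hWx, sub_self])

end ContrastFunction
end LieGroupoid

/-! ### The operators ∇^F and ∇^{F^*} and their descent to E/K^F -/

namespace LieGroupoid

variable {EM : Type*} [NormedAddCommGroup EM] [NormedSpace ℝ EM]
  {M : Type*} [TopologicalSpace M] [ChartedSpace EM M]
  {EG : Type*} [NormedAddCommGroup EG] [NormedSpace ℝ EG]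
  {G : Type*} [TopologicalSpace G] [ChartedSpace EG G]
  {𝒢 : LieGroupoid EM M EG G} [IsManifold 𝓘(ℝ, EG) ∞ G]
  [FiniteDimensional ℝ EM] [IsManifold 𝓘(ℝ, EM) ∞ M] [T2Space M]

/-- The expression `X^L Y^L Z^R f |_M` is a 1-form on the Lie algebroid, as a function of `Z`. -/
theorem exists_thirdDeriv_eq_apply {f : G → ℝ} (hf : ContMDiff 𝓘(ℝ, EG) 𝓘(ℝ, ℝ) ∞ f)
    (X : ∀ x, 𝒢.Fibre x) {Y : ∀ x, 𝒢.Fibre x} (hY : 𝒢.IsSmoothSection Y) :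
    ∃ τ : ∀ x, 𝒢.Fibre x →ₗ[ℝ] ℝ, ∀ Z, 𝒢.IsSmoothSection Z → ∀ x,
      𝒢.thirdDeriv f X Y Z x = τ x (Z x) := by
  -- The form is evaluated on an arbitrary global section through each vector; `key` makes the
  -- choice irrelevant and yields linearity.
  choose S hS hSx using fun (x : M) (e : 𝒢.Fibre x) => 𝒢.exists_isSmoothSection_apply_eq x e
  have key : ∀ Z, 𝒢.IsSmoothSection Z → ∀ Z', 𝒢.IsSmoothSection Z' → ∀ x, Z x = Z' x →
      𝒢.thirdDeriv f X Y Z x = 𝒢.thirdDeriv f X Y Z' x := by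
    intro Z hZ Z' hZ' x hx
    have h1 := thirdDeriv_add_right hf X hY hZ' (hZ.sub hZ') x
    rw [add_sub_cancel, thirdDeriv_eq_zero_of_apply_eq_zero (Z := Z - Z') X Y
      (by rw [Pi.sub_apply, hx, sub_self]), add_zero] at h1
    exact h1
  refine ⟨fun x =>
    { toFun := fun e => 𝒢.thirdDeriv f X Y (S x e) x
      map_add' := fun e e' => ?_
      map_smul' := fun a e => ?_ }, fun Z hZ x => key Z hZ _ (hS _ _) x (hSx _ _).symm⟩
  · rw [← thirdDeriv_add_right hf X hY (hS x e) (hS x e')]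
    exact key _ (hS _ _) _ ((hS _ _).add (hS _ _)) x (by rw [Pi.add_apply, hSx, hSx, hSx])
  · rw [RingHom.id_apply, smul_eq_mul, ← thirdDeriv_smul_right hf X hY a (hS x e)]
    exact key _ (hS _ _) _ ((hS _ _).smul contMDiff_const) x
      (by rw [hSx, hSx])

namespace ContrastFunction

variable {F : 𝒢.ContrastFunction}

/-- The properties of `f = F` and `f = F^*` by which `X^L Y^L Z^R f |_M` defines a transversal
connection. -/
structure IsTransversal (F : 𝒢.ContrastFunction) (f : G → ℝ) : Prop where
  contMDiff : ContMDiff 𝓘(ℝ, EG) 𝓘(ℝ, ℝ) ∞ f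
  right : ∀ X Y Z, 𝒢.IsSmoothSection X → 𝒢.IsSmoothSection Y → 𝒢.IsSmoothSection Z →
    ∀ x, Z x ∈ F.kernel x → 𝒢.thirdDeriv f X Y Z x = 0
  middle : ∀ X Y Z, 𝒢.IsSmoothSection X → 𝒢.IsSmoothSection Y → 𝒢.IsSmoothSection Z →
    ∀ x, (∀ᶠ y in 𝓝 x, Y y ∈ F.kernel y) → 𝒢.thirdDeriv f X Y Z x = 0

/-- The transversal metric is nondegenerate and values of global sections exhaust each fibre;
uniqueness of ∇ rests on this. -/
theorem eq_of_forall_transMetric_coset_eq {x : M} {d d' : F.TransFibre x}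
    (h : ∀ Z, 𝒢.IsSmoothSection Z →
      F.transMetric x d (F.coset Z x) = F.transMetric x d' (F.coset Z x)) : d = d' := by
  rw [← sub_eq_zero]
  refine eq_zero_of_transMetric_eq_zero fun c => ?_
  obtain ⟨e, rfl⟩ := Submodule.Quotient.mk_surjective _ c
  obtain ⟨W, hW, rfl⟩ := 𝒢.exists_isSmoothSection_apply_eq x e
  rw [map_sub, LinearMap.sub_apply, sub_eq_zero]
  exact h W hW

variable [FiniteDimensional ℝ EG] {f : G → ℝ} {X Y Z : ∀ x, 𝒢.Fibre x}

/-- The property `middle` is the duality formula: for Y in K^F near x its right side is the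
derivative of a function vanishing near x, and the F^* term vanishes by the Koszul condition in its
last slot. -/
theorem IsKoszul.isTransversal (hF : F.IsKoszul) : F.IsTransversal F.toFun where
  contMDiff := F.contMDiff
  right X Y _ hX hY hZ _ hx := hF.regular.thirdDeriv_eq_zero_of_mem_kernel F.contMDiff hY
    (fun W hW => hF.thirdDeriv_eq_zero X Y W hX hY hW) hZ hx
  middle X Y Z hX hY hZ x hx := by
    have h1 := F.thirdDeriv_add_thirdDeriv_star X hY hZ x
    have h2 : 𝒢.thirdDeriv F.star.toFun X Z Y x = 0 :=
      hF.regular.thirdDeriv_eq_zero_of_mem_kernel F.star.contMDiff hZ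
        (fun W hW => hF.thirdDeriv_star_eq_zero X Z W hX hZ hW) hY hx.self_of_nhds
    rwa [h2, add_zero, anchorDeriv_eq_zero] at h1
    filter_upwards [hx] with y hy
    have h3 : F.metric y (Y y) = 0 := hy
    rw [h3, LinearMap.zero_apply]

theorem IsKoszul.isTransversal_star (hF : F.IsKoszul) : F.IsTransversal F.star.toFun where
  contMDiff := F.star.contMDiff
  right X Y _ hX hY hZ _ hx := hF.regular.thirdDeriv_eq_zero_of_mem_kernel F.star.contMDiff hY
    (fun W hW => hF.thirdDeriv_star_eq_zero X Y W hX hY hW) hZ hx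
  middle X Y Z hX hY hZ x hx := by
    have h1 := F.thirdDeriv_add_thirdDeriv_star X hZ hY x
    have h2 : 𝒢.thirdDeriv F.toFun X Z Y x = 0 :=
      hF.regular.thirdDeriv_eq_zero_of_mem_kernel F.contMDiff hZ
        (fun W hW => hF.thirdDeriv_eq_zero X Z W hX hZ hW) hY hx.self_of_nhds
    rwa [h2, zero_add, anchorDeriv_eq_zero] at h1
    filter_upwards [hx] with y hy
    have h3 : F.metric y (Y y) = 0 := hy
    rw [F.metric_symm, h3, LinearMap.zero_apply]

/-- Locally, the equation that defines `koszulOp` has a smooth solution. -/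
theorem IsTransversal.exists_local_solution (hf : F.IsTransversal f) (hF : F.IsRegular)
    (hX : 𝒢.IsSmoothSection X) (hY : 𝒢.IsSmoothSection Y) (x₀ : M) :
    ∃ D, 𝒢.IsSmoothSection D ∧ ∀ᶠ x in 𝓝 x₀, ∀ Z, 𝒢.IsSmoothSection Z →
      F.transMetric x (F.coset D x) (F.coset Z x) = 𝒢.thirdDeriv f X Y Z x := by
  obtain ⟨τ, hτ⟩ := exists_thirdDeriv_eq_apply hf.contMDiff X hY
  have hτ0 : ∀ x e, F.metric x e = 0 → τ x e = 0 := by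
    intro x e he
    obtain ⟨W, hW, rfl⟩ := 𝒢.exists_isSmoothSection_apply_eq x e
    rw [← hτ W hW, hf.right X Y W hX hY hW x he]
  obtain ⟨r, Z, N, hZ, hN, hev⟩ := hF.exists_frame x₀
  -- This is the representative of `τ` in the span of the frame; its coefficients are smooth since
  -- `τ` on a frame section is a third derivative.
  refine ⟨fun x => ∑ i, (∑ j, τ x (Z j x) * N x j i) • Z i x,
    IsSmoothSection.sum _ (fun i => contMDiff_finsetSum fun j _ => ContMDiff.mul ?_ (hN j i)) hZ,
    ?_⟩
  · simp only [← hτ _ (hZ j)]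
    exact contMDiff_thirdDeriv hf.contMDiff hX hY (hZ j)
  · filter_upwards [hev] with x hx W hW
    rw [coset, coset, F.transMetric_mk, hτ W hW]
    exact apply_sum_gram_inverse_eq hx.1 (F.metric_symm x) hx.2 (τ x) (hτ0 x) (W x)

namespace IsTransversal

theorem transMetric_koszulOp (hf : F.IsTransversal f) (hF : F.IsRegular)
    (hX : 𝒢.IsSmoothSection X) (hY : 𝒢.IsSmoothSection Y)
    (hZ : 𝒢.IsSmoothSection Z) (x : M) :
    F.transMetric x (F.koszulOp f X Y x) (F.coset Z x) = 𝒢.thirdDeriv f X Y Z x := by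
  obtain ⟨D, -, hD⟩ := hf.exists_local_solution hF hX hY x
  exact Classical.epsilon_spec (p := fun d : F.TransFibre x => ∀ Z, 𝒢.IsSmoothSection Z →
    F.transMetric x d (F.coset Z x) = 𝒢.thirdDeriv f X Y Z x) ⟨_, hD.self_of_nhds⟩ Z hZ

theorem eq_koszulOp_iff (hf : F.IsTransversal f) (hF : F.IsRegular)
    (hX : 𝒢.IsSmoothSection X) (hY : 𝒢.IsSmoothSection Y)
    (σ : ∀ x, F.TransFibre x) :
    σ = F.koszulOp f X Y ↔ ∀ Z, 𝒢.IsSmoothSection Z → ∀ x,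
      F.transMetric x (σ x) (F.coset Z x) = 𝒢.thirdDeriv f X Y Z x := by
  refine ⟨?_, fun h => funext fun x => eq_of_forall_transMetric_coset_eq fun Z hZ => ?_⟩
  · rintro rfl Z hZ x
    exact hf.transMetric_koszulOp hF hX hY hZ x
  · rw [h Z hZ, hf.transMetric_koszulOp hF hX hY hZ]

theorem isSmoothTransSection_koszulOp (hf : F.IsTransversal f) (hF : F.IsRegular)
    (hX : 𝒢.IsSmoothSection X) (hY : 𝒢.IsSmoothSection Y) :
    F.IsSmoothTransSection (F.koszulOp f X Y) := by
  intro x₀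
  obtain ⟨D, hD, hev⟩ := hf.exists_local_solution hF hX hY x₀
  refine ⟨D, hD, ?_⟩
  filter_upwards [hev] with x hx
  refine eq_of_forall_transMetric_coset_eq fun Z hZ => ?_
  rw [hx Z hZ, hf.transMetric_koszulOp hF hX hY hZ]

/-- The difference of the two sections lies in K^F near x, so `middle` applies. Agreement near x is
assumed because this slot is differentiated along X. -/
theorem koszulOp_congr (hf : F.IsTransversal f) (hF : F.IsRegular)
    (hX : 𝒢.IsSmoothSection X) (hY : 𝒢.IsSmoothSection Y)
    {Y' : ∀ x, 𝒢.Fibre x} (hY' : 𝒢.IsSmoothSection Y') {x : M}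
    (h : ∀ᶠ y in 𝓝 x, F.coset Y y = F.coset Y' y) :
    F.koszulOp f X Y x = F.koszulOp f X Y' x := by
  refine eq_of_forall_transMetric_coset_eq fun Z hZ => ?_
  rw [hf.transMetric_koszulOp hF hX hY hZ, hf.transMetric_koszulOp hF hX hY' hZ]
  have h1 := thirdDeriv_add_middle hf.contMDiff X hY' (hY.sub hY') hZ x
  rw [add_sub_cancel, hf.middle X _ Z hX (hY.sub hY') hZ x, add_zero] at h1
  · exact h1
  · filter_upwards [h] with y hy
    exact (Submodule.Quotient.eq _).1 hy

/-- Any two local lifts of σ have the same coset near x, so the lift chosen in `inducedOp` does not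
matter. -/
theorem inducedOp_koszulOp (hf : F.IsTransversal f) (hF : F.IsRegular)
    (hX : 𝒢.IsSmoothSection X) (hY : 𝒢.IsSmoothSection Y)
    {σ : ∀ x, F.TransFibre x} {x : M} (h : ∀ᶠ y in 𝓝 x, σ y = F.coset Y y) :
    F.inducedOp (F.koszulOp f X) σ x = F.koszulOp f X Y x := by
  obtain ⟨Y', hY', hσ, hd⟩ := Classical.epsilon_spec (p := fun d : F.TransFibre x => ∃ Y,
    𝒢.IsSmoothSection Y ∧ (∀ᶠ y in 𝓝 x, σ y = F.coset Y y) ∧ d = F.koszulOp f X Y x)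
    ⟨_, Y, hY, h, rfl⟩
  refine hd.trans (hf.koszulOp_congr hF hX hY' hY ?_)
  filter_upwards [h, hσ] with y h1 h2
  rw [← h1, h2]

theorem isSmoothTransSection_inducedOp (hf : F.IsTransversal f) (hF : F.IsRegular)
    (hX : 𝒢.IsSmoothSection X) {σ : ∀ x, F.TransFibre x}
    (hσ : F.IsSmoothTransSection σ) :
    F.IsSmoothTransSection (F.inducedOp (F.koszulOp f X) σ) := by
  intro x₀
  obtain ⟨Y, hY, hev⟩ := hσ x₀
  obtain ⟨D, hD, hevD⟩ := hf.isSmoothTransSection_koszulOp hF hX hY x₀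
  refine ⟨D, hD, ?_⟩
  -- The one lift `Y` represents σ near every point close to `x₀`, hence computes the induced
  -- operator at all of them.
  filter_upwards [hev.eventually_nhds, hevD] with x h1 h2
  rw [hf.inducedOp_koszulOp hF hX hY h1, h2]

end IsTransversal

/-- The duality of `∇^F` and `∇^{F^*}` with respect to the transversal metric. -/
theorem IsKoszul.transMetric_nabla_add (hF : F.IsKoszul) (hX : 𝒢.IsSmoothSection X)
    (hY : 𝒢.IsSmoothSection Y) (hZ : 𝒢.IsSmoothSection Z) (x : M) :
    F.transMetric x (F.nabla X Y x) (F.coset Z x) +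
        F.transMetric x (F.coset Y x) (F.nablaStar X Z x) =
      𝒢.anchorDeriv X (fun y => F.transMetric y (F.coset Y y) (F.coset Z y)) x := by
  rw [transMetric_symm x (F.coset Y x), nabla, nablaStar,
    hF.isTransversal.transMetric_koszulOp hF.regular hX hY hZ,
    hF.isTransversal_star.transMetric_koszulOp hF.regular hX hZ hY,
    F.thirdDeriv_add_thirdDeriv_star X hY hZ]
  simp only [coset, F.transMetric_mk]

end ContrastFunction
end LieGroupoid

/-! ### Existence, uniqueness, descent and duality combined -/

theorem mainTheorem7
    {EM : Type*} [NormedAddCommGroup EM] [NormedSpace ℝ EM] [FiniteDimensional ℝ EM]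
    {M : Type*} [TopologicalSpace M] [ChartedSpace EM M] [IsManifold 𝓘(ℝ, EM) ∞ M] [T2Space M]
    {EG : Type*} [NormedAddCommGroup EG] [NormedSpace ℝ EG] [FiniteDimensional ℝ EG]
    {G : Type*} [TopologicalSpace G] [ChartedSpace EG G] [IsManifold 𝓘(ℝ, EG) ∞ G]
    (𝒢 : LieGroupoid EM M EG G) (F : 𝒢.ContrastFunction) (hF : F.IsKoszul) :
    -- `∇^F_X Y` and `∇^{F^*}_X Y` are smooth sections of `E / K^F`, and the only solutions of
    -- their defining equations
    (∀ X Y, 𝒢.IsSmoothSection X → 𝒢.IsSmoothSection Y →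
      F.IsSmoothTransSection (F.nabla X Y) ∧ F.IsSmoothTransSection (F.nablaStar X Y) ∧
      (∀ σ : ∀ x, F.TransFibre x, σ = F.nabla X Y ↔ ∀ Z, 𝒢.IsSmoothSection Z → ∀ x,
        F.transMetric x (σ x) (F.coset Z x) = 𝒢.thirdDeriv F.toFun X Y Z x) ∧
      (∀ σ : ∀ x, F.TransFibre x, σ = F.nablaStar X Y ↔ ∀ Z, 𝒢.IsSmoothSection Z → ∀ x,
        F.transMetric x (σ x) (F.coset Z x) = 𝒢.thirdDeriv F.star.toFun X Y Z x)) ∧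
    -- the duality, for arbitrary representatives `DY` and `DZ` in `E` of `∇^F_X Y` and `∇^{F^*}_X Z`
    (∀ X Y Z, 𝒢.IsSmoothSection X → 𝒢.IsSmoothSection Y → 𝒢.IsSmoothSection Z →
      ContMDiff 𝓘(ℝ, EM) 𝓘(ℝ, ℝ) ∞ (fun x => F.metric x (Y x) (Z x)) ∧
      ∀ DY DZ : ∀ x, 𝒢.Fibre x, F.coset DY = F.nabla X Y → F.coset DZ = F.nablaStar X Z → ∀ x,
        F.metric x (DY x) (Z x) + F.metric x (Y x) (DZ x) =
          𝒢.anchorDeriv X (fun y => F.metric y (Y y) (Z y)) x) ∧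
    -- the duality in terms of the transversal metric
    (∀ X Y Z, 𝒢.IsSmoothSection X → 𝒢.IsSmoothSection Y → 𝒢.IsSmoothSection Z → ∀ x,
      F.transMetric x (F.nabla X Y x) (F.coset Z x) +
          F.transMetric x (F.coset Y x) (F.nablaStar X Z x) =
        𝒢.anchorDeriv X (fun y => F.transMetric y (F.coset Y y) (F.coset Z y)) x) ∧
    -- `∇^F_X` and `∇^{F^*}_X` induce operators on the sections of `E / K^F`
    (∀ X Y, 𝒢.IsSmoothSection X → 𝒢.IsSmoothSection Y →
      F.transNabla X (F.coset Y) = F.nabla X Y ∧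
      F.transNablaStar X (F.coset Y) = F.nablaStar X Y) ∧
    (∀ X σ, 𝒢.IsSmoothSection X → F.IsSmoothTransSection σ →
      F.IsSmoothTransSection (F.transNabla X σ) ∧
      F.IsSmoothTransSection (F.transNablaStar X σ)) ∧
    -- these induced operators are dual with respect to the transversal metric
    (∀ X σ τ, 𝒢.IsSmoothSection X → F.IsSmoothTransSection σ → F.IsSmoothTransSection τ →
      ContMDiff 𝓘(ℝ, EM) 𝓘(ℝ, ℝ) ∞ (fun x => F.transMetric x (σ x) (τ x)) ∧
      ∀ x, F.transMetric x (F.transNabla X σ x) (τ x) +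
          F.transMetric x (σ x) (F.transNablaStar X τ x) =
        𝒢.anchorDeriv X (fun y => F.transMetric y (σ y) (τ y)) x) := by
  refine ⟨fun X Y hX hY => ⟨hF.isTransversal.isSmoothTransSection_koszulOp hF.regular hX hY,
    hF.isTransversal_star.isSmoothTransSection_koszulOp hF.regular hX hY,
    hF.isTransversal.eq_koszulOp_iff hF.regular hX hY,
    hF.isTransversal_star.eq_koszulOp_iff hF.regular hX hY⟩,
    fun X Y Z hX hY hZ => ⟨F.contMDiff_metric hY hZ, fun DY DZ hDY hDZ x => ?_⟩,
    fun X Y Z hX hY hZ => hF.transMetric_nabla_add hX hY hZ,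
    fun X Y hX hY => ⟨funext fun x => ?_, funext fun x => ?_⟩,
    fun X σ hX hσ => ⟨hF.isTransversal.isSmoothTransSection_inducedOp hF.regular hX hσ,
      hF.isTransversal_star.isSmoothTransSection_inducedOp hF.regular hX hσ⟩,
    fun X σ τ hX hσ hτ => ⟨fun x => ?_, fun x => ?_⟩⟩
  · have h := hF.transMetric_nabla_add hX hY hZ x
    rw [← hDY, ← hDZ] at h
    simp only [LieGroupoid.ContrastFunction.coset, F.transMetric_mk] at h
    exact h
  · exact hF.isTransversal.inducedOp_koszulOp hF.regular hX hY
      (Filter.Eventually.of_forall fun _ => rfl)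
  · exact hF.isTransversal_star.inducedOp_koszulOp hF.regular hX hY
      (Filter.Eventually.of_forall fun _ => rfl)
  · obtain ⟨Y, hY, hσY⟩ := hσ x
    obtain ⟨Z, hZ, hτZ⟩ := hτ x
    refine (F.contMDiff_metric hY hZ x).congr_of_eventuallyEq ?_
    filter_upwards [hσY, hτZ] with y h1 h2
    rw [h1, h2]
    exact F.transMetric_mk y _ _
  · obtain ⟨Y, hY, hσY⟩ := hσ x
    obtain ⟨Z, hZ, hτZ⟩ := hτ x
    have h1 : F.transNabla X σ x = F.nabla X Y x :=
      hF.isTransversal.inducedOp_koszulOp hF.regular hX hY hσY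
    have h2 : F.transNablaStar X τ x = F.nablaStar X Z x :=
      hF.isTransversal_star.inducedOp_koszulOp hF.regular hX hZ hτZ
    -- The derivative along the anchor depends only on the germ at `x`, so σ and τ may be replaced
    -- by their local lifts.
    have h3 : (fun y => F.transMetric y (σ y) (τ y)) =ᶠ[𝓝 x]
        fun y => F.transMetric y (F.coset Y y) (F.coset Z y) := by
      filter_upwards [hσY, hτZ] with y h1 h2
      rw [h1, h2]
    rw [h1, h2, hσY.self_of_nhds, hτZ.self_of_nhds, hF.transMetric_nabla_add hX hY hZ,
      LieGroupoid.anchorDeriv, LieGroupoid.anchorDeriv, h3.mfderiv_eq]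
    rfl
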